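/- **Setting.** Let $n$ be a natural number and let $A,B\in \mathrm{M}_n(\mathbb Z)$ be non-singular. For a non-singular $A\in\mathrm M_n(\mathbb Z)$ with characteristic polynomial $h_A$ put $$G_A=\{A^{-k}\mathbf x : \mathbf x\in\mathbb Z^n,\ k\in\mathbb Z\}\subseteq\mathbb Q^n,\qquad \mathcal R(A)=\mathbb Z\left[\tfrac1{\det A}\right]\subseteq\mathbb Q,$$ $$\mathcal P(A)=\{p\text{ prime}: p\mid\det A\},\qquad \mathcal P'(A)=\{p\in\mathcal P(A): h_A\not\equiv x^n \pmod p\},$$ let $t_p(A)$ be the multiplicity of zero as a root of $h_A$ modulo $p$, and let $\overline G_{A,p}=G_A\otimes_{\mathbb Z}\mathbb Z_p\subseteq\mathbb Q_p^n$. A family of $p$-adic integers $\alpha_{pij}(A)\in\mathbb Z_p$, $p\in\mathcal P'(A)$, $1\le i\le t_p(A)<j\le n$, is the *characteristic* of $G_A$ relative to the standard basis $\mathbf e_1,\dots,\mathbf e_n$ of $\mathbb Z^n$ if for every $p\in\mathcal P'(A)$, with $t=t_p(A)$ and $\mathbf x_{pi}=\mathbf e_i+\sum_{j=t+1}^n\alpha_{pij}(A)\,\mathbf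 e_j$ for $1\le i\le t$, $$\overline G_{A,p}=\mathrm{Span}_{\mathbb Q_p}(\mathbf x_{p1},\dots,\mathbf x_{pt})\oplus\mathrm{Span}_{\mathbb Z_p}(\mathbf e_{t+1},\dots,\mathbf e_n).$$ Given such a characteristic of $G_B$, a matrix $T=(\gamma_{ij})\in\mathrm{GL}_n(\mathbb Q)$ *satisfies the condition* $(A,B,p)$, $p\in\mathcal P'(B)$, if, with $t=t_p(B)$, $$\gamma_{kj}-\sum_{i=1}^{t}\gamma_{ij}\,\alpha_{pik}(B)\in\mathbb Z_p\qquad\text{for all }k,j\in\{t+1,\dots,n\}.$$ Let $K$ be any number field that contains the eigenvalues of both $A$ and $B$. For a prime ideal $\mathfrak p$ of $\mathcal O_K$ let $X_{A,\mathfrak p}\subseteq K^n$ be the $K$-span of the generalized eigenvectors of $A$ whose eigenvalues are divisible by $\mathfrak p$, and similarly for $B$. **Theorem.** Assume that $G_A$ and $G_B$ have characteristics $\{\alpha_{pij}(A)\}$ and $\{\alpha_{pij}(B)\}$ relative to the standard basis. For $T\in\mathrm{GL}_n(\mathbb Q)$ we have $T(G_A)=G_B$ if and only if all of the following hold: 1.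 $\mathcal P(A)=\mathcal P(B)$, $\mathcal P'(A)=\mathcal P'(B)$, $\mathcal R(A)=\mathcal R(B)$, and $t_p(A)=t_p(B)$ for all $p\in\mathcal P(A)$; 2. $T\in\mathrm{GL}_n(\mathcal R(A))$; 3. for every $p\in\mathcal P'(A)$ and every prime ideal $\mathfrak p$ of $\mathcal O_K$ above $p$, $T(X_{A,\mathfrak p})=X_{B,\mathfrak p}$; 4. for every $p\in\mathcal P'(A)$, $T$ satisfies the condition $(A,B,p)$ and $T^{-1}$ satisfies the condition $(B,A,p)$. The equivalence also holds with 3 replaced by the requirement that for every $p\in\mathcal P'(A)$ there is some prime ideal $\mathfrak p$ of $\mathcal O_K$ above $p$ with $T(X_{A,\mathfrak p})=X_{B,\mathfrak p}$. -/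

import Mathlib

open scoped NumberField

namespace Solenoid

noncomputable section

/-- The group `G_A = {A^{-k} x : x ∈ ℤⁿ, k ∈ ℤ}`, as a subset of `ℚⁿ`. -/
def G {n : ℕ} (A : Matrix (Fin n) (Fin n) ℤ) : Set (Fin n → ℚ) :=
  {v | ∃ (k : ℤ) (x : Fin n → ℤ),
    v = ((A.map (Int.cast : ℤ → ℚ)) ^ (-k)).mulVec (fun i => (x i : ℚ))}

/-- `𝒫(A)`: the set of prime divisors of `det A`. -/
def primeSet {n : ℕ} (A : Matrix (Fin n) (Fin n) ℤ) : Set ℕ :=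
  {p | p.Prime ∧ (p : ℤ) ∣ A.det}

/-- `𝒫'(A)`: the primes `p ∈ 𝒫(A)` for which the characteristic polynomial of `A` is not
congruent to `xⁿ` modulo `p`. -/
def primeSet' {n : ℕ} (A : Matrix (Fin n) (Fin n) ℤ) : Set ℕ :=
  {p | p ∈ primeSet A ∧ A.charpoly.map (Int.castRingHom (ZMod p)) ≠ Polynomial.X ^ n}

/-- `t_p(A)`: the multiplicity of zero in the reduction modulo `p` of the characteristic
polynomial of `A`. -/
def zeroMult {n : ℕ} (A : Matrix (Fin n) (Fin n) ℤ) (p : ℕ) : ℕ :=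
  (A.charpoly.map (Int.castRingHom (ZMod p))).rootMultiplicity 0

/-- The ring `ℛ(A) = ℤ[1 / det A] ⊆ ℚ`. -/
def R {n : ℕ} (A : Matrix (Fin n) (Fin n) ℤ) : Subalgebra ℤ ℚ :=
  Algebra.adjoin ℤ {((A.det : ℤ) : ℚ)⁻¹}

/-- `GL_n(ℛ(A))` as a subgroup of `GL_n(ℚ)`. -/
def GLR {n : ℕ} (A : Matrix (Fin n) (Fin n) ℤ) : Subgroup (GL (Fin n) ℚ) :=
  (Matrix.GeneralLinearGroup.map (n := Fin n) (algebraMap (R A) ℚ)).range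

/-- `G_A ⊗ ℤ_p`, regarded as a `ℤ_p`-submodule of `ℚ_pⁿ`. -/
def Gbar {n : ℕ} (A : Matrix (Fin n) (Fin n) ℤ) (p : ℕ) [Fact p.Prime] :
    Submodule ℤ_[p] (Fin n → ℚ_[p]) :=
  Submodule.span ℤ_[p] ((fun (v : Fin n → ℚ) (i : Fin n) => ((v i : ℚ) : ℚ_[p])) '' G A)

/-- A vector of `ℤⁿ` regarded as a vector of `ℚ_pⁿ`. -/
def toPadic {n : ℕ} (p : ℕ) [Fact p.Prime] (v : Fin n → ℤ) : Fin n → ℚ_[p] :=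
  fun i => ((v i : ℤ) : ℚ_[p])

/-- The vector `x_{pi} = f_i + ∑_{j > t} α_{ij} f_j`. Indices start from `0`, so that `i ≤ t < j`
in the usual numbering reads `i < t ≤ j` here. -/
def charVec {n : ℕ} (f : Module.Basis (Fin n) ℤ (Fin n → ℤ)) (p : ℕ) [Fact p.Prime] (t : ℕ)
    (α : Fin n → Fin n → ℤ_[p]) (i : Fin n) : Fin n → ℚ_[p] :=
  toPadic p (f i) + ∑ j ∈ Finset.univ.filter (fun j : Fin n => t ≤ j.val),
    (α i j : ℚ_[p]) • toPadic p (f j)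

/-- The family `{α_{pij} : p ∈ 𝒫'(A), i ≤ t_p < j}` is the characteristic of `G_A` relative to the
ordered basis `f` of `ℤⁿ`: for each `p ∈ 𝒫'(A)`, with `t = t_p(A)`,
`G_A ⊗ ℤ_p = Span_{ℚ_p}(x_{p1}, …, x_{pt}) ⊕ Span_{ℤ_p}(f_{t+1}, …, f_n)`.
(The sum is automatically direct, since `x_{p1}, …, x_{pt}, f_{t+1}, …, f_n` is a basis of `ℚ_pⁿ`.)
Entries of `α` outside the index range `p ∈ 𝒫'(A)`, `i ≤ t_p < j` are irrelevant. -/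
def IsCharacteristic {n : ℕ} (A : Matrix (Fin n) (Fin n) ℤ)
    (f : Module.Basis (Fin n) ℤ (Fin n → ℤ))
    (α : (p : ℕ) → [Fact p.Prime] → Fin n → Fin n → ℤ_[p]) : Prop :=
  ∀ (p : ℕ) [Fact p.Prime], p ∈ primeSet' A →
    Gbar A p =
      (Submodule.span ℚ_[p]
        (charVec f p (zeroMult A p) (α p) '' {i | i.val < zeroMult A p})).restrictScalars ℤ_[p] ⊔
      Submodule.span ℤ_[p] ((fun j => toPadic p (f j)) '' {j | zeroMult A p ≤ j.val})

/-- The integrality condition `(A, B, p)` on `T = (γ_{ij})`: with `t = t_p(B)` and `α = α(B)`,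
`γ_{kj} - ∑_{i ≤ t} γ_{ij} α_{pik} ∈ ℤ_p` for all `k, j ∈ {t + 1, …, n}`.
It depends on `A` only through the domain of `T`. -/
def Cond {n : ℕ} (B : Matrix (Fin n) (Fin n) ℤ) (p : ℕ) [Fact p.Prime]
    (α : Fin n → Fin n → ℤ_[p]) (T : GL (Fin n) ℚ) : Prop :=
  ∀ k j : Fin n, zeroMult B p ≤ k.val → zeroMult B p ≤ j.val →
    ((T k j : ℚ) : ℚ_[p]) -
      ∑ i ∈ Finset.univ.filter (fun i : Fin n => i.val < zeroMult B p),
        ((T i j : ℚ) : ℚ_[p]) * (α i k : ℚ_[p]) ∈ PadicInt.subring p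

/-- `X_{A,𝔭}`: the `K`-span of the generalized eigenvectors of `A` in `Kⁿ` whose eigenvalues are
divisible by `𝔭`. (Eigenvalues of `A` are algebraic integers; the generalized eigenspace of a
`μ` that is not an eigenvalue is zero.) -/
def X {n : ℕ} (A : Matrix (Fin n) (Fin n) ℤ) (K : Type*) [Field K] (𝔭 : Ideal (𝓞 K)) :
    Submodule K (Fin n → K) :=
  ⨆ μ ∈ 𝔭, Module.End.maxGenEigenspace (Matrix.toLin' (A.map (Int.cast : ℤ → K))) (μ : K)

/-- `T(X_{A,𝔭}) = X_{B,𝔭}`, with `T` acting on `Kⁿ`. -/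
def MapsX {n : ℕ} (A B : Matrix (Fin n) (Fin n) ℤ) (K : Type*) [Field K] [NumberField K]
    (𝔭 : Ideal (𝓞 K)) (T : GL (Fin n) ℚ) : Prop :=
  (X A K 𝔭).map (Matrix.toLin' ((T : Matrix (Fin n) (Fin n) ℚ).map (algebraMap ℚ K))) = X B K 𝔭

end

end Solenoid

/-! For a subring `O` of a field, `stab O A` collects the vectors that some power of `A` carries
into `Oⁿ`. Over `ℤ` it is `G A` (`mem_G_iff`), so `T(G_A) = G_B` says that `T` and `T⁻¹` exchange
the modules `stab intRing A` and `stab intRing B`.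

The main tool is a Fitting decomposition over the valuation ring `O` of `K` at `𝔭`. The
characteristic polynomial factors as `g * f`, the roots of `f` lying in the maximal ideal and those
of `g` being units. The two factors are coprime already over `O`, so the projection with kernel
direction `X_{A,𝔭}` is integral on `stab O A` (`exists_projection`). Hence `X_{A,𝔭}` consists of the
`v` whose whole line `K v` lies in `stab O A` (`mem_nilPart_iff`).

Necessity: this description of `X_{A,𝔭}` is carried along by `T`, which gives condition 3. The index
of `p G_A` in `G_A` is `p ^ (n - t_p)` (`relIndex_stab`), so the group determines `t_p`, and with it
`𝒫`, `𝒫'` and `ℛ`. Conditions 2 and 4 come from applying `T` and `T⁻¹` to the standard basis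
vectors, which lie in `G_A` and `G_B`.

Sufficiency: membership in `G_B` is tested one prime at a time (`mem_stab_intRing_of_local`). If `p
∤ det A`, condition 2 makes everything `p`-integral. If `p ∈ 𝒫 \ 𝒫'`, then `G_B` is `p`-divisible
and nothing has to be checked. If `p ∈ 𝒫'`, then `stab O A` lies in the sum of `X_{A,𝔭}` and the
`O`-span of the `e_j` beyond `t_p` (`IsCharacteristic.stab_le`); condition 3 handles the first
summand and condition 4 the second. As `O ∩ ℚ` is the localization of `ℤ` at `p`, one `𝔭` above `p`
is enough. -/

namespace Solenoid

open Polynomial Module.End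

/-! ### Vectors made integral by a power of `A` -/

section Stab

variable {n : ℕ} {F : Type*} [Field F]

/-- The vectors of `Fⁿ` with coordinates in the subring `O`. -/
def lattice (n : ℕ) (O : Subring F) : Submodule O (Fin n → F) where
  carrier := {v | ∀ i, v i ∈ O}
  add_mem' hv hw i := O.add_mem (hv i) (hw i)
  zero_mem' _ := O.zero_mem
  smul_mem' c _ hv i := O.mul_mem c.2 (hv i)

/-- The endomorphism of `Fⁿ` given by an integral matrix. -/
noncomputable def toEnd (F : Type*) [Field F] (A : Matrix (Fin n) (Fin n) ℤ) :
    Module.End F (Fin n → F) :=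
  Matrix.toLin' (A.map (Int.cast : ℤ → F))

theorem toEnd_pow_apply (A : Matrix (Fin n) (Fin n) ℤ) (k : ℕ) (v : Fin n → F) :
    (toEnd F A ^ k) v = ((A.map (Int.cast : ℤ → F)) ^ k).mulVec v := by
  rw [toEnd, ← Matrix.toLin'_pow, Matrix.toLin'_apply]

theorem toEnd_mem_lattice (O : Subring F) (A : Matrix (Fin n) (Fin n) ℤ) {v : Fin n → F}
    (hv : v ∈ lattice n O) : toEnd F A v ∈ lattice n O := fun i => by
  rw [toEnd, Matrix.toLin'_apply, Matrix.mulVec, dotProduct]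
  refine O.sum_mem fun j _ => O.mul_mem ?_ (hv j)
  exact intCast_mem O _

theorem toEnd_pow_mem_lattice (O : Subring F) (A : Matrix (Fin n) (Fin n) ℤ) (k : ℕ)
    {v : Fin n → F} (hv : v ∈ lattice n O) : (toEnd F A ^ k) v ∈ lattice n O := by
  induction k with
  | zero => simpa using hv
  | succ k ih => rw [pow_succ', Module.End.mul_apply]; exact toEnd_mem_lattice O A ih

theorem toEnd_pow_mem_lattice_of_le (O : Subring F) (A : Matrix (Fin n) (Fin n) ℤ) {k l : ℕ}
    (h : k ≤ l) {v : Fin n → F} (hv : (toEnd F A ^ k) v ∈ lattice n O) :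
    (toEnd F A ^ l) v ∈ lattice n O := by
  obtain ⟨m, rfl⟩ := Nat.exists_eq_add_of_le' h
  rw [pow_add, Module.End.mul_apply]
  exact toEnd_pow_mem_lattice O A m hv

/-- The vectors of `Fⁿ` which some power of `A` maps into `Oⁿ`. -/
noncomputable def stab (O : Subring F) (A : Matrix (Fin n) (Fin n) ℤ) :
    Submodule O (Fin n → F) where
  carrier := {v | ∃ k : ℕ, (toEnd F A ^ k) v ∈ lattice n O}
  add_mem' := by
    rintro v w ⟨k, hk⟩ ⟨l, hl⟩
    refine ⟨max k l, ?_⟩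
    rw [map_add]
    exact add_mem (toEnd_pow_mem_lattice_of_le O A (le_max_left _ _) hk)
      (toEnd_pow_mem_lattice_of_le O A (le_max_right _ _) hl)
  zero_mem' := ⟨0, by simp⟩
  smul_mem' := by
    rintro c v ⟨k, hk⟩
    refine ⟨k, ?_⟩
    rw [LinearMap.map_smul_of_tower]
    exact Submodule.smul_mem _ c hk

theorem mem_stab {O : Subring F} {A : Matrix (Fin n) (Fin n) ℤ} {v : Fin n → F} :
    v ∈ stab O A ↔ ∃ k : ℕ, (toEnd F A ^ k) v ∈ lattice n O := Iff.rfl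

theorem lattice_le_stab (O : Subring F) (A : Matrix (Fin n) (Fin n) ℤ) :
    lattice n O ≤ stab O A := fun v hv => ⟨0, by simpa using hv⟩

end Stab

/-! ### Integral Fitting decomposition over a valuation ring -/

section Valuation

variable {n : ℕ} {K : Type*} [Field K] (O : ValuationSubring K)

/-- The sum of the generalized eigenspaces of `A` for topologically nilpotent eigenvalues. -/
noncomputable def nilPart (A : Matrix (Fin n) (Fin n) ℤ) : Submodule K (Fin n → K) :=
  ⨆ μ : {μ : K // μ ∈ O.nonunits}, maxGenEigenspace (toEnd K A) (μ : K)

theorem ker_aeval_prod_le_iSup {V : Type*} [AddCommGroup V] [Module K V] (a : Module.End K V)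
    (s : Multiset K) {p : K → Prop} (hs : ∀ μ ∈ s, p μ) :
    LinearMap.ker (aeval a (s.map fun μ => Polynomial.X - C μ).prod) ≤
      ⨆ μ : {μ : K // p μ}, maxGenEigenspace a (μ : K) := by
  classical
  rw [Finset.prod_multiset_map_count]
  suffices h : ∀ t : Finset K, (∀ μ ∈ t, p μ) →
      LinearMap.ker (aeval a (∏ μ ∈ t, (Polynomial.X - C μ) ^ s.count μ)) ≤
        ⨆ μ : {μ : K // p μ}, maxGenEigenspace a (μ : K) from
    h _ fun μ hμ => hs μ (Multiset.mem_toFinset.mp hμ)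
  intro t
  induction t using Finset.induction_on with
  | empty => intro _ v hv; simp_all
  | insert μ t hμ ih =>
    intro ht
    rw [Finset.prod_insert hμ, ← sup_ker_aeval_eq_ker_aeval_mul_of_coprime]
    · refine sup_le ?_ (ih fun ν hν => ht ν (Finset.mem_insert_of_mem hν))
      refine le_trans ?_ (le_iSup (fun ν : {ν : K // p ν} => maxGenEigenspace a (ν : K))
        ⟨μ, ht μ (Finset.mem_insert_self _ _)⟩)
      intro v hv
      rw [mem_maxGenEigenspace]
      refine ⟨s.count μ, ?_⟩
      simpa [Algebra.algebraMap_eq_smul_one] using hv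
    · refine IsCoprime.prod_right fun ν hν => IsCoprime.pow ?_
      exact isCoprime_X_sub_C_of_isUnit_sub
        (sub_ne_zero_of_ne (ne_of_mem_of_not_mem hν hμ).symm).isUnit

theorem aeval_mem_lattice (A : Matrix (Fin n) (Fin n) ℤ) (q : O[X]) {v : Fin n → K}
    (hv : v ∈ lattice n O.toSubring) : aeval (toEnd K A) q v ∈ lattice n O.toSubring := by
  induction q using Polynomial.induction_on' with
  | add p q hp hq => rw [map_add]; exact add_mem hp hq
  | monomial k c =>
    rw [aeval_monomial, Module.End.mul_apply, Module.algebraMap_end_apply]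
    exact Submodule.smul_mem (lattice n O.toSubring) (c : O.toSubring)
      (toEnd_pow_mem_lattice _ A k hv)

/-- The eigenvalues are integral over `ℤ`, and a valuation ring is integrally closed, so the
splitting over `K` already takes place over `O`. -/
theorem exists_multiset_charpoly_eq (A : Matrix (Fin n) (Fin n) ℤ)
    (hA : (A.map (Int.cast : ℤ → K)).charpoly.Splits) :
    ∃ s : Multiset O, A.charpoly.map (Int.castRingHom O) = (s.map fun r => Polynomial.X - C r).prod := by
  have hmap : (A.map (Int.cast : ℤ → K)).charpoly = A.charpoly.map (Int.castRingHom K) :=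
    (Matrix.charpoly_map A (Int.castRingHom K))
  have hroots : ∀ r ∈ (A.map (Int.cast : ℤ → K)).charpoly.roots, r ∈ O := by
    intro r hr
    have h1 : (A.charpoly.map (Int.castRingHom K)).IsRoot r := by
      rw [← hmap]; exact isRoot_of_mem_roots hr
    have h2 : IsIntegral ℤ r := ⟨A.charpoly, A.charpoly_monic, by
      rw [IsRoot, eval_map] at h1
      exact h1⟩
    have h3 : IsIntegral O r := h2.tower_top
    obtain ⟨y, hy⟩ := IsIntegrallyClosed.isIntegral_iff.mp h3
    rw [← hy]
    exact y.2
  have hprod := hA.eq_prod_roots_of_monic (Matrix.charpoly_monic _)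
  obtain ⟨s, hs⟩ : ∃ s : Multiset O, s.map (fun x : O => (x : K)) =
      (A.map (Int.cast : ℤ → K)).charpoly.roots := by
    lift (A.map (Int.cast : ℤ → K)).charpoly.roots to Multiset O using hroots with s hs
    exact ⟨s, rfl⟩
  refine ⟨s, map_injective O.subtype O.subtype_injective ?_⟩
  rw [Polynomial.map_map, Polynomial.map_multiset_prod, Multiset.map_map,
    RingHom.ext_int (O.subtype.comp (Int.castRingHom O)) (Int.castRingHom K), ← hmap]
  rw [← hs, Multiset.map_map] at hprod
  rw [hprod]
  simp

/-- The integral Fitting decomposition: a linear projection along the topologically nilpotent part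
which is integral on `stab`. -/
theorem exists_projection (A : Matrix (Fin n) (Fin n) ℤ)
    (hA : (A.map (Int.cast : ℤ → K)).charpoly.Splits) :
    ∃ P : Module.End K (Fin n → K), (∀ v, v - P v ∈ nilPart O A) ∧
      ∀ v ∈ stab O.toSubring A, P v ∈ lattice n O.toSubring := by
  classical
  obtain ⟨s, hs⟩ := exists_multiset_charpoly_eq O A hA
  set a := toEnd K A with ha
  set f : O[X] := ((s.filter fun r => ¬ IsUnit r).map fun r => Polynomial.X - C r).prod with hf
  set g : O[X] := ((s.filter fun r => IsUnit r).map fun r => Polynomial.X - C r).prod with hg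
  have hfg : g * f = A.charpoly.map (Int.castRingHom O) := by
    rw [hs, hf, hg, ← Multiset.prod_add, ← Multiset.map_add, Multiset.filter_add_not]
  have hCH : aeval a (g * f) = 0 := by
    rw [hfg]
    have h := Matrix.aeval_self_charpoly (A.map (Int.cast : ℤ → K))
    have hmap : (A.map (Int.cast : ℤ → K)).charpoly = A.charpoly.map (Int.castRingHom K) :=
      (Matrix.charpoly_map A (Int.castRingHom K))
    have h2 : aeval a (A.charpoly.map (Int.castRingHom K)) = 0 := by
      rw [← hmap, ha, toEnd, show Matrix.toLin' (A.map (Int.cast : ℤ → K)) =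
        Matrix.toLinAlgEquiv' (A.map (Int.cast : ℤ → K)) from rfl, ← AlgEquiv.coe_toAlgHom,
        aeval_algHom_apply, h, map_zero]
    rw [aeval_def, eval₂_map] at h2 ⊢
    rw [← h2]
    congr 1
  have hcop : ∀ c : O, ¬ IsUnit c → IsCoprime (Polynomial.X - C c) g := by
    intro c hc
    have : ∀ t : Multiset O, (∀ r ∈ t, IsUnit r) →
        IsCoprime (Polynomial.X - C c) (t.map fun r => Polynomial.X - C r).prod := by
      intro t
      induction t using Multiset.induction_on with
      | empty => intro _; simpa using isCoprime_one_right
      | cons r t ih =>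
        intro ht
        rw [Multiset.map_cons, Multiset.prod_cons]
        refine IsCoprime.mul_right (isCoprime_X_sub_C_of_isUnit_sub ?_)
          (ih fun x hx => ht x (Multiset.mem_cons_of_mem hx))
        -- If `c - r` were a nonunit, then so would be `(c - r) + (-c) = -r`, since `O` is local.
        by_contra h
        have h3 := IsLocalRing.nonunits_add (a := c - r) (b := -c) h (by simpa using hc)
        apply h3
        have := (ht r (Multiset.mem_cons_self _ _)).neg
        convert this using 1
        ring
    exact this _ fun r hr => (Multiset.mem_filter.mp hr).2
  have hfgcop : IsCoprime f g := by
    have : ∀ t : Multiset O, (∀ r ∈ t, ¬ IsUnit r) →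
        IsCoprime (t.map fun r => Polynomial.X - C r).prod g := by
      intro t
      induction t using Multiset.induction_on with
      | empty => intro _; simpa using isCoprime_one_left
      | cons r t ih =>
        intro ht
        rw [Multiset.map_cons, Multiset.prod_cons]
        exact IsCoprime.mul_left (hcop r (ht r (Multiset.mem_cons_self _ _)))
          (ih fun x hx => ht x (Multiset.mem_cons_of_mem hx))
    exact this _ fun r hr => (Multiset.mem_filter.mp hr).2
  have hXcop : IsCoprime Polynomial.X g := by simpa using hcop 0 (by simp)
  obtain ⟨u, w, huw⟩ := hfgcop
  -- With `u f + w g = 1`, the complement of `P = (u f)(A)` is `(w g)(A)`, whose image is killed by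
  -- `f(A)` by Cayley–Hamilton.
  refine ⟨aeval a (u * f), fun v => ?_, fun v hv => ?_⟩
  · have h1 : v - aeval a (u * f) v = aeval a (w * g) v := by
      rw [sub_eq_iff_eq_add, ← LinearMap.add_apply, ← map_add, add_comm, huw]
      simp
    rw [h1]
    have h2 : aeval a f (aeval a (w * g) v) = 0 := by
      rw [← Module.End.mul_apply, ← map_mul, show f * (w * g) = w * (g * f) by ring, map_mul, hCH]
      simp
    have h3 : aeval a f = aeval a (((s.filter fun r => ¬ IsUnit r).map
        (fun r : O => (r : K))).map fun r => Polynomial.X - C r).prod := by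
      rw [← aeval_map_algebraMap K, hf, Polynomial.map_multiset_prod, Multiset.map_map,
        Multiset.map_map]
      congr 3
      ext r
      simp
    refine ker_aeval_prod_le_iSup a ((s.filter fun r => ¬ IsUnit r).map fun r : O => (r : K))
      (p := fun μ => μ ∈ O.nonunits) ?_ ?_
    · intro μ hμ
      obtain ⟨r, hr, rfl⟩ := Multiset.mem_map.mp hμ
      rw [ValuationSubring.coe_mem_nonunits_iff]
      exact (Multiset.mem_filter.mp hr).2
    · rw [LinearMap.mem_ker, ← h3, h2]
  · obtain ⟨k, hk⟩ := hv
    obtain ⟨r, q, hrq⟩ := hXcop.pow_left (m := k)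
    have h1 : aeval a (u * f) v = aeval a (r * u * f) ((a ^ k) v) := by
      -- From `r X^k + q g = 1`, multiplied by `u f`. The second term vanishes at `A`, so `P v`
      -- depends only on the integral vector `A^k v`, through a polynomial over `O`.
      have h2 : u * f = r * u * f * Polynomial.X ^ k + q * u * (g * f) := by
        linear_combination (-u * f) * hrq
      rw [h2, map_add, map_mul _ _ (g * f), hCH, map_mul _ _ (Polynomial.X ^ k)]
      simp
    rw [h1]
    exact aeval_mem_lattice O A _ hk

-- On a generalized eigenspace for `μ`, expand `A^l = (b + μ)^l` with `b` nilpotent: only boundedly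
-- many powers of `b` survive, each with a high power of `μ`. The hypothesis `hO` (powers of
-- nonunits absorb any denominator) makes these terms integral.
variable {O} in
theorem nilPart_le_stab (hO : ∀ μ ∈ O.nonunits, ∀ c : K, ∃ N : ℕ, μ ^ N * c ∈ O)
    (A : Matrix (Fin n) (Fin n) ℤ) {v : Fin n → K} (hv : v ∈ nilPart O A) :
    v ∈ stab O.toSubring A := by
  have hN : ∀ μ ∈ O.nonunits, ∀ v : Fin n → K, ∃ N : ℕ, ∀ l, N ≤ l →
      μ ^ l • v ∈ lattice n O.toSubring := by
    intro μ hμ v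
    choose N hN using fun i => hO μ hμ (v i)
    refine ⟨Finset.univ.sup N, fun l hl i => ?_⟩
    have h1 : N i ≤ l := (Finset.le_sup (Finset.mem_univ i)).trans hl
    obtain ⟨m, rfl⟩ := Nat.exists_eq_add_of_le' h1
    rw [Pi.smul_apply, smul_eq_mul, pow_add, mul_assoc]
    exact O.mul_mem _ _ (pow_mem (O.nonunits_subset hμ) m) (hN i)
  refine Submodule.iSup_induction _ (motive := fun v => v ∈ stab O.toSubring A) hv ?_
    (zero_mem _) fun _ _ => add_mem
  rintro ⟨μ, hμ⟩ x hx
  rw [mem_maxGenEigenspace] at hx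
  obtain ⟨m, hm⟩ := hx
  set b := toEnd K A - μ • (1 : Module.End K (Fin n → K)) with hb
  choose N hN using fun i => hN μ hμ ((b ^ i) x)
  -- The summand `m` ensures that the exponent of `μ` stays at least `N i` in the terms with `i <
  -- m`.
  refine ⟨(Finset.range m).sup N + m, ?_⟩
  have h1 : toEnd K A = b + algebraMap K _ μ := by
    rw [hb, Algebra.algebraMap_eq_smul_one, sub_add_cancel]
  rw [h1, (Algebra.commute_algebraMap_right μ b).add_pow, LinearMap.sum_apply]
  refine Submodule.sum_mem _ fun i hi => ?_
  rw [← map_pow, ← map_natCast (algebraMap K (Module.End K (Fin n → K))),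
    mul_assoc, ← map_mul, ← Algebra.commutes, Module.End.mul_apply, Module.algebraMap_end_apply]
  by_cases him : m ≤ i
  · obtain ⟨j, rfl⟩ := Nat.exists_eq_add_of_le' him
    rw [pow_add, Module.End.mul_apply, hm, map_zero, smul_zero]
    exact zero_mem _
  · push Not at him
    rw [mul_comm, mul_smul]
    have h2 : N i ≤ (Finset.range m).sup N := Finset.le_sup (Finset.mem_range.mpr him)
    have h3 := hN i ((Finset.range m).sup N + m - i) (by omega)
    intro j
    rw [Pi.smul_apply, smul_eq_mul]
    exact O.mul_mem _ _ (natCast_mem O.toSubring _) (h3 j)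

/-- The right-hand side mentions only the module `stab`, so any linear map between such modules
respects `nilPart`. If `P v ≠ 0`, a coordinate of `P (c • v)` takes every value in `K` as `c`
varies, yet it must stay in `O ≠ ⊤`. -/
theorem mem_nilPart_iff (hO : ∀ μ ∈ O.nonunits, ∀ c : K, ∃ N : ℕ, μ ^ N * c ∈ O) (hOtop : O ≠ ⊤)
    (A : Matrix (Fin n) (Fin n) ℤ) (hA : (A.map (Int.cast : ℤ → K)).charpoly.Splits)
    {v : Fin n → K} : v ∈ nilPart O A ↔ ∀ c : K, c • v ∈ stab O.toSubring A := by
  refine ⟨fun hv c => nilPart_le_stab hO A (Submodule.smul_mem _ c hv), fun hv => ?_⟩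
  obtain ⟨P, hP, hP'⟩ := exists_projection O A hA
  have : P v = 0 := by
    by_contra h
    obtain ⟨i, hi⟩ := Function.ne_iff.mp h
    refine hOtop (top_unique fun c _ => ?_)
    have h1 := hP' _ (hv (c * (P v i)⁻¹)) i
    rw [map_smul, Pi.smul_apply, smul_eq_mul, mul_assoc, inv_mul_cancel₀ hi, mul_one] at h1
    exact h1
  simpa [this] using hP v

end Valuation

/-! ### Passing between `ℤ`, its localizations and `ℤ_p` -/

section Comparison

variable {n : ℕ} {F F' : Type*} [Field F] [Field F']

/-- The subring `ℤ` of `ℚ`. -/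
def intRing : Subring ℚ := (Int.castRingHom ℚ).range

theorem mem_lattice_intRing {v : Fin n → ℚ} :
    v ∈ lattice n intRing ↔ ∃ x : Fin n → ℤ, v = fun i => (x i : ℚ) := by
  refine ⟨fun h => ?_, ?_⟩
  · choose x hx using h
    exact ⟨x, funext fun i => (hx i).symm⟩
  · rintro ⟨x, rfl⟩ i
    exact ⟨x i, rfl⟩

theorem toEnd_pow_comp (φ : F →+* F') (A : Matrix (Fin n) (Fin n) ℤ) (k : ℕ) (v : Fin n → F) :
    (toEnd F' A ^ k) (φ ∘ v) = φ ∘ (toEnd F A ^ k) v := by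
  induction k with
  | zero => rfl
  | succ k ih =>
    rw [pow_succ', Module.End.mul_apply, ih, pow_succ', Module.End.mul_apply]
    ext i
    simp only [toEnd, Matrix.toLin'_apply, Function.comp_apply]
    rw [RingHom.map_mulVec, Matrix.map_map]
    congr 2
    ext
    simp

/-- This moves rational vectors between `ℚ`, `K` and `ℚ_p`: only the trace of `O` on the smaller
field matters. -/
theorem comp_mem_stab_iff (φ : F →+* F') (O : Subring F') (A : Matrix (Fin n) (Fin n) ℤ)
    {v : Fin n → F} : φ ∘ v ∈ stab O A ↔ v ∈ stab (O.comap φ) A := by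
  simp only [mem_stab, toEnd_pow_comp]
  rfl

theorem toEnd_pow_intCast (A : Matrix (Fin n) (Fin n) ℤ) (k : ℕ) (x : Fin n → ℤ) :
    (toEnd F A ^ k) (fun i => (x i : F)) = fun i => (((A ^ k).mulVec x i : ℤ) : F) := by
  ext i
  rw [toEnd_pow_apply]
  have h := RingHom.map_mulVec (Int.castRingHom F) (A ^ k) x i
  rw [Matrix.map_pow] at h
  exact h.symm

theorem mem_G_iff {A : Matrix (Fin n) (Fin n) ℤ} (hA : A.det ≠ 0) {v : Fin n → ℚ} :
    v ∈ G A ↔ v ∈ stab intRing A := by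
  have hdet : IsUnit (A.map (Int.cast : ℤ → ℚ)).det := by
    have h := (Int.castRingHom ℚ).map_det A
    rw [RingHom.mapMatrix_apply, Int.coe_castRingHom] at h
    rw [← h]
    simpa using hA
  constructor
  · rintro ⟨k, x, rfl⟩
    rcases Int.le_total k 0 with hk | hk
    · obtain ⟨m, hm⟩ := Int.exists_eq_neg_ofNat hk
      apply lattice_le_stab
      rw [hm, neg_neg, zpow_natCast, ← toEnd_pow_apply]
      exact toEnd_pow_mem_lattice _ A m (mem_lattice_intRing.mpr ⟨x, rfl⟩)
    · obtain ⟨m, rfl⟩ := Int.eq_ofNat_of_zero_le hk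
      refine ⟨m, ?_⟩
      rw [toEnd_pow_apply, Matrix.mulVec_mulVec, ← zpow_natCast, ← Matrix.zpow_add hdet,
        add_neg_cancel, zpow_zero, Matrix.one_mulVec]
      exact mem_lattice_intRing.mpr ⟨x, rfl⟩
  · rintro ⟨k, hk⟩
    obtain ⟨x, hx⟩ := mem_lattice_intRing.mp hk
    refine ⟨k, x, ?_⟩
    rw [← hx, toEnd_pow_apply, Matrix.mulVec_mulVec, ← zpow_natCast, ← Matrix.zpow_add hdet,
      neg_add_cancel, zpow_zero, Matrix.one_mulVec]

/-- The localization of `ℤ` at `p`, as a subring of `ℚ`. -/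
noncomputable def localInt (p : ℕ) [Fact p.Prime] : Subring ℚ :=
  (PadicInt.subring p).comap (Rat.castHom ℚ_[p])

theorem mem_localInt {p : ℕ} [Fact p.Prime] {q : ℚ} : q ∈ localInt p ↔ ¬ p ∣ q.den := by
  refine ⟨fun h hd => ?_, fun h => Padic.norm_rat_le_one h⟩
  have h1 : ‖(q : ℚ_[p])‖ ≤ 1 := h
  have h2 : ‖((q.den : ℤ) : ℚ_[p])‖ < 1 := by
    rw [Padic.norm_intCast_lt_one_iff]
    exact_mod_cast hd
  have h3 : ¬ ‖((q.num : ℤ) : ℚ_[p])‖ < 1 := by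
    rw [Padic.norm_intCast_lt_one_iff]
    intro h4
    have h5 : p ∣ q.num.natAbs := Int.natCast_dvd.mp h4
    exact (Fact.out : p.Prime).one_lt.ne' (Nat.dvd_one.mp (q.reduced ▸ Nat.dvd_gcd h5 hd))
  apply h3
  have h4 : ((q.num : ℤ) : ℚ_[p]) = (q : ℚ_[p]) * ((q.den : ℤ) : ℚ_[p]) := by
    have := congrArg (Rat.cast : ℚ → ℚ_[p]) (Rat.mul_den_eq_num q)
    push_cast at this ⊢
    exact this.symm
  rw [h4, norm_mul]
  calc _ ≤ 1 * ‖((q.den : ℤ) : ℚ_[p])‖ := by gcongr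
    _ < 1 := by rwa [one_mul]

theorem prod_den_smul_mem_lattice (w : Fin n → ℚ) :
    (((∏ i, (w i).den : ℕ) : ℚ)) • w ∈ lattice n intRing := by
  intro i
  refine ⟨(∏ j ∈ Finset.univ.erase i, ((w j).den : ℤ)) * (w i).num, ?_⟩
  rw [Pi.smul_apply, smul_eq_mul, ← Finset.prod_erase_mul _ _ (Finset.mem_univ i)]
  have := Rat.mul_den_eq_num (w i)
  simp only [eq_intCast, Int.cast_mul, ← this]
  push_cast
  ring

theorem exists_smul_mem_of_mem_stab_localInt {p : ℕ} [hp : Fact p.Prime]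
    {A : Matrix (Fin n) (Fin n) ℤ} {v : Fin n → ℚ} (hv : v ∈ stab (localInt p) A) :
    ∃ m : ℤ, ¬ (p : ℤ) ∣ m ∧ (m : ℚ) • v ∈ stab intRing A := by
  obtain ⟨k, hk⟩ := hv
  set w := (toEnd ℚ A ^ k) v
  refine ⟨∏ i, ((w i).den : ℤ), ?_, k, ?_⟩
  · rw [(Nat.prime_iff_prime_int.mp hp.out).dvd_finsetProd_iff]
    rintro ⟨i, -, hi⟩
    exact mem_localInt.mp (hk i) (by exact_mod_cast hi)
  · rw [map_smul]
    simpa using prod_den_smul_mem_lattice w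

/-- The integers `m` with `m v` in the module form an ideal; the hypothesis keeps it out of every
maximal ideal of `ℤ`, so it contains `1`. -/
theorem mem_stab_intRing_of_local {A : Matrix (Fin n) (Fin n) ℤ} {v : Fin n → ℚ}
    (h : ∀ p : ℕ, p.Prime → ∃ m : ℤ, ¬ (p : ℤ) ∣ m ∧ (m : ℚ) • v ∈ stab intRing A) :
    v ∈ stab intRing A := by
  let I : Ideal ℤ :=
    { carrier := {m | (m : ℚ) • v ∈ stab intRing A}
      add_mem' := fun {a b} ha hb => by
        simp only [Set.mem_ofPred_eq, Int.cast_add, add_smul] at *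
        exact add_mem ha hb
      zero_mem' := by simp
      smul_mem' := fun c m hm => by
        simp only [Set.mem_ofPred_eq, smul_eq_mul, Int.cast_mul, mul_smul] at *
        exact Submodule.smul_mem (stab intRing A) (⟨(c : ℚ), c, rfl⟩ : intRing) hm }
  by_cases hI : I = ⊤
  · have : (1 : ℤ) ∈ I := hI ▸ Submodule.mem_top
    simpa [I] using this
  · obtain ⟨M, hM, hIM⟩ := Ideal.exists_le_maximal I hI
    obtain ⟨q, rfl⟩ : ∃ q : ℤ, M = Ideal.span {q} :=
      ⟨_, (Submodule.IsPrincipal.span_singleton_generator M).symm⟩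
    have hq : q ≠ 0 := by
      rintro rfl
      -- Any prime would do: an `m` not divisible by it is a nonzero element of `I`.
      obtain ⟨m, hm, hm'⟩ := h 2 Nat.prime_two
      have := hIM (show m ∈ I from hm')
      simp only [Ideal.span_singleton_zero, Ideal.mem_bot] at this
      exact hm (this ▸ dvd_zero _)
    have hqp : Prime q := (Ideal.span_singleton_prime hq).mp hM.isPrime
    obtain ⟨m, hm, hm'⟩ := h q.natAbs (Int.prime_iff_natAbs_prime.mp hqp)
    have := Ideal.mem_span_singleton.mp (hIM (show m ∈ I from hm'))
    exact absurd (Int.natAbs_dvd.mpr this) hm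

theorem mem_stab_of_mem_Gbar {A : Matrix (Fin n) (Fin n) ℤ} (hA : A.det ≠ 0) {p : ℕ}
    [Fact p.Prime] {w : Fin n → ℚ_[p]} (hw : w ∈ Gbar A p) : w ∈ stab (PadicInt.subring p) A := by
  induction hw using Submodule.span_induction with
  | mem x hx =>
    obtain ⟨v, hv, rfl⟩ := hx
    obtain ⟨k, hk⟩ := (mem_G_iff hA).mp hv
    refine (comp_mem_stab_iff (Rat.castHom ℚ_[p]) _ A).mpr ⟨k, fun i => ?_⟩
    obtain ⟨x, hx⟩ := hk i
    rw [← hx]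
    exact intCast_mem (localInt p) x
  | zero => exact zero_mem _
  | add x y _ _ hx hy => exact add_mem hx hy
  | smul c x _ hx => exact Submodule.smul_mem _ (⟨c.1, c.2⟩ : PadicInt.subring p) hx

theorem mem_stab_localInt_of_mem_Gbar {A : Matrix (Fin n) (Fin n) ℤ} (hA : A.det ≠ 0) {p : ℕ}
    [Fact p.Prime] {v : Fin n → ℚ} (hv : (fun i => ((v i : ℚ) : ℚ_[p])) ∈ Gbar A p) :
    v ∈ stab (localInt p) A :=
  (comp_mem_stab_iff (Rat.castHom ℚ_[p]) _ A).mp (mem_stab_of_mem_Gbar hA hv)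

end Comparison

/-! ### The index of `p G_A` in `G_A` determines `t_p` -/

section Multiplicity

variable {n : ℕ}

theorem charpoly_map_zmod (A : Matrix (Fin n) (Fin n) ℤ) (p : ℕ) [Fact p.Prime] :
    (toEnd (ZMod p) A).charpoly = A.charpoly.map (Int.castRingHom (ZMod p)) := by
  rw [toEnd, Matrix.charpoly_toLin']
  exact Matrix.charpoly_map A (Int.castRingHom (ZMod p))

theorem finrank_maxGenEigenspace_eq_zeroMult (A : Matrix (Fin n) (Fin n) ℤ) (p : ℕ)
    [Fact p.Prime] :
    Module.finrank (ZMod p) (maxGenEigenspace (toEnd (ZMod p) A) 0) = zeroMult A p := by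
  rw [LinearMap.finrank_maxGenEigenspace_zero_eq, charpoly_map_zmod, zeroMult,
    rootMultiplicity_eq_natTrailingDegree']

theorem zeroMult_le (A : Matrix (Fin n) (Fin n) ℤ) (p : ℕ) [Fact p.Prime] : zeroMult A p ≤ n := by
  rw [← finrank_maxGenEigenspace_eq_zeroMult]
  simpa using Submodule.finrank_le (maxGenEigenspace (toEnd (ZMod p) A) 0)

theorem mem_primeSet_iff (A : Matrix (Fin n) (Fin n) ℤ) (p : ℕ) [hp : Fact p.Prime] :
    p ∈ primeSet A ↔ 0 < zeroMult A p := by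
  have hmonic := A.charpoly_monic.map (Int.castRingHom (ZMod p))
  rw [zeroMult, rootMultiplicity_pos hmonic.ne_zero, IsRoot, eval_map, eval₂_at_zero,
    Matrix.charpoly, ← Matrix.charpoly]
  have h1 : A.det = (-1) ^ n * A.charpoly.coeff 0 := by
    simpa using A.det_eq_sign_charpoly_coeff
  have h2 : p ∈ primeSet A ↔ (p : ℤ) ∣ A.det := ⟨And.right, fun h => ⟨hp.out, h⟩⟩
  rw [h2, h1, eq_intCast, ZMod.intCast_zmod_eq_zero_iff_dvd]
  exact (IsUnit.dvd_mul_left ((isUnit_one.neg).pow n))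

/-- With `mem_primeSet_iff`, this reduces the equalities of `𝒫` and `𝒫'` to that of the numbers
`t_p`. -/
theorem mem_primeSet'_iff (A : Matrix (Fin n) (Fin n) ℤ) (p : ℕ) [hp : Fact p.Prime] :
    p ∈ primeSet' A ↔ 0 < zeroMult A p ∧ zeroMult A p < n := by
  have hmonic := A.charpoly_monic.map (Int.castRingHom (ZMod p))
  have hdeg : (A.charpoly.map (Int.castRingHom (ZMod p))).natDegree = n := by
    rw [A.charpoly_monic.natDegree_map, Matrix.charpoly_natDegree_eq_dim, Fintype.card_fin]
  refine and_congr (mem_primeSet_iff A p) ?_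
  rw [(zeroMult_le A p).lt_iff_ne, not_iff_not]
  refine ⟨fun h => by rw [zeroMult, h, rootMultiplicity_eq_natTrailingDegree', natTrailingDegree_X_pow],
    fun h => ?_⟩
  have h1 := pow_rootMultiplicity_dvd (A.charpoly.map (Int.castRingHom (ZMod p))) 0
  rw [← zeroMult, h, C_0, sub_zero] at h1
  exact eq_of_monic_of_dvd_of_natDegree_le (monic_X_pow n) hmonic h1
    (by rw [hdeg, natDegree_X_pow])

/-- Multiplication by `p` on `ℚⁿ`. -/
def mulHom (n p : ℕ) : (Fin n → ℚ) →+ (Fin n → ℚ) :=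
  DistribSMul.toAddMonoidHom _ (p : ℚ)

theorem mem_map_mulHom_iff {A : Matrix (Fin n) (Fin n) ℤ} {p : ℕ} [hp : Fact p.Prime]
    {v : Fin n → ℚ} : v ∈ (stab intRing A).toAddSubgroup.map (mulHom n p) ↔
      ∃ (k : ℕ) (x : Fin n → ℤ), (toEnd ℚ A ^ k) v = fun i => (((p : ℤ) * x i : ℤ) : ℚ) := by
  have hp0 : (p : ℚ) ≠ 0 := Nat.cast_ne_zero.mpr hp.out.ne_zero
  constructor
  · rintro ⟨w, ⟨k, hk⟩, rfl⟩
    obtain ⟨x, hx⟩ := mem_lattice_intRing.mp hk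
    refine ⟨k, x, ?_⟩
    change (toEnd ℚ A ^ k) ((p : ℚ) • w) = _
    rw [map_smul, hx]
    ext i
    simp
  · rintro ⟨k, x, hx⟩
    refine ⟨(p : ℚ)⁻¹ • v, ⟨k, mem_lattice_intRing.mpr ⟨x, ?_⟩⟩, smul_inv_smul₀ hp0 v⟩
    rw [map_smul, hx]
    ext i
    simp [hp0]

theorem toEnd_zmod_pow_apply_eq_iff (A : Matrix (Fin n) (Fin n) ℤ) (p : ℕ) [Fact p.Prime]
    (k : ℕ) (x y : Fin n → ℤ) :
    (toEnd (ZMod p) A ^ k) (fun i => (x i : ZMod p)) = (fun i => (y i : ZMod p)) ↔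
      ∃ z : Fin n → ℤ, (toEnd ℚ A ^ k) (fun i => (x i : ℚ)) =
        fun i => ((y i + (p : ℤ) * z i : ℤ) : ℚ) := by
  simp only [toEnd_pow_intCast, funext_iff, Int.cast_inj]
  rw [← Classical.skolem (p := fun i z => (A ^ k).mulVec x i = y i + (p : ℤ) * z)]
  refine forall_congr' fun i => ?_
  rw [eq_comm, ZMod.intCast_eq_intCast_iff_dvd_sub]
  exact exists_congr fun z => sub_eq_iff_eq_add'

theorem stab_le_lattice_sup (A : Matrix (Fin n) (Fin n) ℤ) (p : ℕ) [Fact p.Prime] :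
    (stab intRing A).toAddSubgroup ≤ (lattice n intRing).toAddSubgroup ⊔
      (stab intRing A).toAddSubgroup.map (mulHom n p) := by
  rintro v ⟨k, hk⟩
  obtain ⟨x, hx⟩ := mem_lattice_intRing.mp hk
  -- Once the images of the powers of `A` modulo `p` are stable, `A^j x ≡ A^(j+k) z` for some
  -- integral `z`. With `A^k v = x`, this makes `A^(j+k) (v - z)` divisible by `p`.
  obtain ⟨j, hj⟩ := IsArtinian.monotone_stabilizes
    (LinearMap.iterateRange (toEnd (ZMod p) A))
  have h1 : (toEnd (ZMod p) A ^ j) (fun i => (x i : ZMod p)) ∈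
      LinearMap.range (toEnd (ZMod p) A ^ (j + k)) := by
    have : LinearMap.range (toEnd (ZMod p) A ^ j) = LinearMap.range (toEnd (ZMod p) A ^ (j + k)) :=
      hj (j + k) (Nat.le_add_right _ _)
    rw [← this]
    exact LinearMap.mem_range_self _ _
  obtain ⟨z', hz'⟩ := h1
  obtain ⟨z, rfl⟩ : ∃ z : Fin n → ℤ, z' = fun i => (z i : ZMod p) := by
    choose z hz using fun i => ZMod.intCast_surjective (z' i)
    exact ⟨z, funext fun i => (hz i).symm⟩
  rw [toEnd_pow_intCast (A := A) (k := j), toEnd_zmod_pow_apply_eq_iff] at hz'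
  obtain ⟨y, hy⟩ := hz'
  refine AddSubgroup.mem_sup.mpr ⟨fun i => (z i : ℚ), mem_lattice_intRing.mpr ⟨z, rfl⟩,
    v - fun i => (z i : ℚ), mem_map_mulHom_iff.mpr ⟨j + k, -y, ?_⟩, by abel⟩
  rw [map_sub, hy, pow_add, Module.End.mul_apply, hx, toEnd_pow_intCast]
  ext i
  simp

/-- Since `S = ℤⁿ + pS`, the quotient `S / pS` is `ℤⁿ / (ℤⁿ ∩ pS)`. An integral `x` lies in `pS`
exactly when a power of `A` kills it modulo `p`, so the quotient is `𝔽_pⁿ` modulo the generalized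
kernel of `A`, of dimension `n - t_p`. -/
theorem relIndex_stab (A : Matrix (Fin n) (Fin n) ℤ) (p : ℕ) [Fact p.Prime] :
    ((stab intRing A).toAddSubgroup.map (mulHom n p)).relIndex (stab intRing A).toAddSubgroup =
      p ^ (n - zeroMult A p) := by
  set S := (stab intRing A).toAddSubgroup with hS
  set pS := S.map (mulHom n p) with hpS
  have hle : pS ≤ S := by
    rintro _ ⟨w, hw, rfl⟩
    exact Submodule.smul_mem (stab intRing A) (⟨(p : ℚ), p, by simp⟩ : intRing) hw
  have hsup : S = (lattice n intRing).toAddSubgroup ⊔ pS :=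
    le_antisymm (stab_le_lattice_sup A p) (sup_le (lattice_le_stab _ _) hle)
  let ι : (Fin n → ℤ) →+ (Fin n → ℚ) := (Int.castAddHom ℚ).compLeft (Fin n)
  let red : (Fin n → ℤ) →+ (Fin n → ZMod p) := (Int.castAddHom (ZMod p)).compLeft (Fin n)
  have hι : (lattice n intRing).toAddSubgroup = ι.range := by
    ext v
    exact mem_lattice_intRing.trans ⟨fun ⟨x, hx⟩ => ⟨x, hx.symm⟩, fun ⟨x, hx⟩ => ⟨x, hx.symm⟩⟩
  set N := maxGenEigenspace (toEnd (ZMod p) A) 0 with hN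
  have hcomap : pS.comap ι = N.toAddSubgroup.comap red := by
    ext x
    refine mem_map_mulHom_iff.trans (Iff.trans ?_ (mem_maxGenEigenspace _ _ _).symm)
    refine exists_congr fun k => ?_
    have := toEnd_zmod_pow_apply_eq_iff A p k x 0
    rw [zero_smul, sub_zero]
    simp only [Pi.zero_apply, Int.cast_zero, zero_add] at this
    exact this.symm
  have hred : Function.Surjective red := fun y => by
    choose z hz using fun i => ZMod.intCast_surjective (y i)
    exact ⟨z, funext hz⟩
  rw [hsup, AddSubgroup.relIndex_sup_right, hι, ← AddSubgroup.index_comap, hcomap,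
    AddSubgroup.index_comap_of_surjective _ hred]
  change Nat.card ((Fin n → ZMod p) ⧸ N) = _
  rw [Module.natCard_eq_pow_finrank (K := ZMod p), Nat.card_zmod]
  congr 1
  have h1 := N.finrank_quotient_add_finrank
  rw [finrank_maxGenEigenspace_eq_zeroMult, Module.finrank_fin_fun] at h1
  omega

theorem zeroMult_eq_of_map_eq {A B : Matrix (Fin n) (Fin n) ℤ}
    (T : (Fin n → ℚ) →ₗ[ℚ] (Fin n → ℚ)) (hT : Function.Injective T)
    (h : ∀ v, v ∈ stab intRing B ↔ ∃ w ∈ stab intRing A, T w = v) (p : ℕ) [hp : Fact p.Prime] :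
    zeroMult A p = zeroMult B p := by
  have h1 : (stab intRing A).toAddSubgroup.map T.toAddMonoidHom =
      (stab intRing B).toAddSubgroup := by
    ext v
    exact (h v).symm
  have h2 : ((stab intRing A).toAddSubgroup.map (mulHom n p)).map T.toAddMonoidHom =
      (stab intRing B).toAddSubgroup.map (mulHom n p) := by
    rw [← h1, AddSubgroup.map_map, AddSubgroup.map_map]
    exact congrArg (AddSubgroup.map · _) (AddMonoidHom.ext fun v => T.map_smul (p : ℚ) v)
  have h4 := AddSubgroup.relIndex_map_map_of_injective
    ((stab intRing A).toAddSubgroup.map (mulHom n p)) (stab intRing A).toAddSubgroup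
    (f := T.toAddMonoidHom) hT
  rw [h1] at h4
  rw [h2, relIndex_stab, relIndex_stab] at h4
  have h5 : n - zeroMult A p = n - zeroMult B p := Nat.pow_right_injective hp.out.two_le h4.symm
  have := zeroMult_le A p
  have := zeroMult_le B p
  omega

/-- If `A` is nilpotent modulo `p`, then `stab` is `p`-divisible. -/
theorem inv_smul_mem_stab {A : Matrix (Fin n) (Fin n) ℤ} {p : ℕ} [hp : Fact p.Prime]
    (h : p ∈ primeSet A) (h' : p ∉ primeSet' A) {v : Fin n → ℚ} (hv : v ∈ stab intRing A) :
    (p : ℚ)⁻¹ • v ∈ stab intRing A := by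
  have hp0 : (p : ℚ) ≠ 0 := Nat.cast_ne_zero.mpr hp.out.ne_zero
  have hX : A.charpoly.map (Int.castRingHom (ZMod p)) = Polynomial.X ^ n := by
    by_contra hne
    exact h' ⟨h, hne⟩
  -- Cayley–Hamilton modulo `p`: `A^n` maps `ℤⁿ` into `p ℤⁿ`, which pays for the division by `p`.
  have hnil : toEnd (ZMod p) A ^ n = 0 := by
    have := LinearMap.aeval_self_charpoly (toEnd (ZMod p) A)
    rwa [charpoly_map_zmod, hX, map_pow, aeval_X] at this
  obtain ⟨k, hk⟩ := hv
  obtain ⟨x, hx⟩ := mem_lattice_intRing.mp hk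
  have := toEnd_zmod_pow_apply_eq_iff A p n x 0
  simp only [Pi.zero_apply, Int.cast_zero, zero_add] at this
  obtain ⟨z, hz⟩ := this.mp (by rw [hnil]; rfl)
  refine ⟨n + k, mem_lattice_intRing.mpr ⟨z, ?_⟩⟩
  rw [map_smul, pow_add, Module.End.mul_apply, hx, hz]
  ext i
  simp [hp0]

end Multiplicity

/-! ### Denominators and the ring `ℛ(A)` -/

section Denominators

variable {n : ℕ}

theorem R_le_of_primeSet_subset {A B : Matrix (Fin n) (Fin n) ℤ} (hA : A.det ≠ 0)
    (hB : B.det ≠ 0) (h : primeSet A ⊆ primeSet B) : R A ≤ R B := by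
  have h1 : ∃ N : ℕ, A.det ∣ B.det ^ N := by
    obtain ⟨N, hN⟩ := (UniqueFactorizationMonoid.exists_dvd_pow_iff_radical_dvd
      (a := A.det.natAbs) (b := B.det.natAbs) (by simpa using hA)).mpr (by
        rw [UniqueFactorizationMonoid.radical_dvd_iff_primeFactors_subset (by simpa using hB),
          UniqueFactorizationMonoid.primeFactors_eq_natPrimeFactors]
        intro p hp
        rw [Nat.mem_primeFactors] at hp ⊢
        exact ⟨hp.1, Int.natCast_dvd.mp (h ⟨hp.1, Int.natCast_dvd.mpr hp.2.1⟩).2, by simpa using hB⟩)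
    exact ⟨N, by rwa [← Int.natAbs_dvd_natAbs, Int.natAbs_pow]⟩
  obtain ⟨N, c, hc⟩ := h1
  rw [R, Algebra.adjoin_le_iff, Set.singleton_subset_iff]
  have h2 : ((A.det : ℤ) : ℚ)⁻¹ = c • (((B.det : ℤ) : ℚ)⁻¹) ^ N := by
    have h3 : ((B.det : ℤ) : ℚ) ^ N = A.det * c := by exact_mod_cast hc
    have h4 : ((A.det : ℤ) : ℚ) ≠ 0 := by exact_mod_cast hA
    have h5 : ((B.det : ℤ) : ℚ) ≠ 0 := by exact_mod_cast hB
    rw [zsmul_eq_mul, inv_pow, h3]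
    have h6 : (c : ℚ) ≠ 0 := by
      rintro h7
      rw [h7, mul_zero] at h3
      exact pow_ne_zero _ h5 h3
    field_simp
  rw [h2]
  exact Subalgebra.smul_mem _ (Subalgebra.pow_mem _ (Algebra.self_mem_adjoin_singleton _ _) _) _

/-- When `det A` is invertible in `O`, the adjugate inverts `A` over `O`, so powers of `A` cannot
create integrality. -/
theorem stab_le_lattice {F : Type*} [Field F] [CharZero F] {O : Subring F}
    {A : Matrix (Fin n) (Fin n) ℤ} (hA : A.det ≠ 0) (hO : ((A.det : ℤ) : F)⁻¹ ∈ O) :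
    stab O A ≤ lattice n O := by
  rintro v ⟨k, hk⟩
  induction k with
  | zero => simpa using hk
  | succ k ih =>
    apply ih
    rw [pow_succ', Module.End.mul_apply] at hk
    set w := (toEnd F A ^ k) v
    have h1 : w = ((A.det : ℤ) : F)⁻¹ • toEnd F A.adjugate (toEnd F A w) := by
      have h2 : toEnd F A.adjugate (toEnd F A w) = ((A.det : ℤ) : F) • w := by
        have h3 := congrArg (fun M : Matrix (Fin n) (Fin n) ℤ => M.map (Int.castRingHom F))
          A.adjugate_mul
        simp only [Matrix.map_mul] at h3
        simp only [toEnd, Matrix.toLin'_apply, Matrix.mulVec_mulVec]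
        erw [h3]
        rw [Matrix.map_smul' _ _ _ (map_mul _), Matrix.map_one _ (map_zero _) (map_one _)]
        rw [Matrix.smul_mulVec, Matrix.one_mulVec]
        rfl
      rw [h2, inv_smul_smul₀ (by exact_mod_cast hA)]
    rw [h1]
    exact Submodule.smul_mem (lattice n O) (⟨_, hO⟩ : O) (toEnd_mem_lattice O _ hk)

theorem stab_mono {F : Type*} [Field F] {O O' : Subring F} (h : O ≤ O')
    {A : Matrix (Fin n) (Fin n) ℤ} {v : Fin n → F} (hv : v ∈ stab O A) : v ∈ stab O' A := by
  obtain ⟨k, hk⟩ := hv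
  exact ⟨k, fun i => h (hk i)⟩

theorem intRing_le (O : Subring ℚ) : intRing ≤ O := by
  rintro _ ⟨m, rfl⟩
  exact intCast_mem O m

theorem mem_R_of_mem_stab {A : Matrix (Fin n) (Fin n) ℤ} (hA : A.det ≠ 0) {v : Fin n → ℚ}
    (hv : v ∈ stab intRing A) (i : Fin n) : v i ∈ R A :=
  stab_le_lattice (O := (R A).toSubring) hA (Algebra.self_mem_adjoin_singleton _ _)
    (stab_mono (intRing_le _) hv) i

theorem R_le_localInt {A : Matrix (Fin n) (Fin n) ℤ} {p : ℕ} [hp : Fact p.Prime]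
    (h : p ∉ primeSet A) {q : ℚ} (hq : q ∈ R A) : q ∈ localInt p := by
  induction hq using Algebra.adjoin_induction with
  | mem x hx =>
    rw [Set.mem_singleton_iff.mp hx, mem_localInt]
    intro hd
    rw [Rat.inv_intCast_den] at hd
    split_ifs at hd with h0
    · exact hp.out.one_lt.ne' (Nat.dvd_one.mp hd)
    · exact h ⟨hp.out, Int.natCast_dvd.mpr hd⟩
  | algebraMap r => exact intCast_mem (localInt p) r
  | add x y _ _ hx hy => exact add_mem hx hy
  | mul x y _ _ hx hy => exact mul_mem hx hy

theorem mem_GLR_iff {A : Matrix (Fin n) (Fin n) ℤ} {T : GL (Fin n) ℚ} :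
    T ∈ GLR A ↔ (∀ i j, T i j ∈ R A) ∧ ∀ i j, T⁻¹ i j ∈ R A := by
  constructor
  · rintro ⟨U, rfl⟩
    refine ⟨fun i j => (U i j).2, fun i j => ?_⟩
    rw [← map_inv]
    exact (U⁻¹ i j).2
  · rintro ⟨h, h'⟩
    have hinj : Function.Injective fun M : Matrix (Fin n) (Fin n) (R A) =>
        M.map (algebraMap (R A) ℚ) := Matrix.map_injective Subtype.val_injective
    refine ⟨⟨Matrix.of fun i j => ⟨T i j, h i j⟩, Matrix.of fun i j => ⟨T⁻¹ i j, h' i j⟩,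
      hinj ?_, hinj ?_⟩, ?_⟩
    · simp only [Matrix.map_mul]
      rw [Matrix.map_one _ (map_zero _) (map_one _)]
      exact T.mul_inv
    · simp only [Matrix.map_mul]
      rw [Matrix.map_one _ (map_zero _) (map_one _)]
      exact T.inv_mul
    · ext i j
      rfl

end Denominators

/-! ### Coordinates attached to a characteristic -/

section Characteristic

variable {n : ℕ} {p : ℕ} [hp : Fact p.Prime]

theorem toPadic_basisFun (i : Fin n) :
    toPadic p (Pi.basisFun ℤ (Fin n) i) = Pi.single i (1 : ℚ_[p]) := by
  ext l
  by_cases h : l = i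
  · subst h; simp [toPadic]
  · simp [toPadic, h]

theorem charVec_basisFun_apply (t : ℕ) (α : Fin n → Fin n → ℤ_[p]) (i l : Fin n) :
    charVec (Pi.basisFun ℤ (Fin n)) p t α i l =
      (Pi.single i (1 : ℚ_[p]) : Fin n → ℚ_[p]) l + if t ≤ l.val then (α i l : ℚ_[p]) else 0 := by
  rw [charVec, Pi.add_apply, Finset.sum_apply, toPadic_basisFun, Finset.sum_filter]
  simp only [toPadic_basisFun, Pi.smul_apply, Pi.single_apply, smul_eq_mul, mul_ite, mul_one,
    mul_zero]
  rw [Finset.sum_eq_single l]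
  · simp
  · intro j _ hj
    simp [hj.symm]
  · simp

/-- The `k`-th coordinate, for `k ≥ t`, with respect to the basis
`x_0, …, x_{t-1}, e_t, …, e_{n-1}` of `ℚ_pⁿ`. -/
noncomputable def tailCoord (t : ℕ) (α : Fin n → Fin n → ℤ_[p]) (k : Fin n) :
    (Fin n → ℚ_[p]) →ₗ[ℚ_[p]] ℚ_[p] :=
  LinearMap.proj (R := ℚ_[p]) (φ := fun _ => ℚ_[p]) k -
    ∑ i ∈ Finset.univ.filter (fun i : Fin n => i.val < t),
      (α i k : ℚ_[p]) • LinearMap.proj (R := ℚ_[p]) (φ := fun _ => ℚ_[p]) i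

theorem tailCoord_apply (t : ℕ) (α : Fin n → Fin n → ℤ_[p]) (k : Fin n) (w : Fin n → ℚ_[p]) :
    tailCoord t α k w = w k - ∑ i ∈ Finset.univ.filter (fun i : Fin n => i.val < t),
      w i * (α i k : ℚ_[p]) := by
  simp [tailCoord, mul_comm]

theorem tailCoord_charVec (t : ℕ) (α : Fin n → Fin n → ℤ_[p]) {i k : Fin n} (hi : i.val < t)
    (hk : t ≤ k.val) : tailCoord t α k (charVec (Pi.basisFun ℤ (Fin n)) p t α i) = 0 := by
  rw [tailCoord_apply, charVec_basisFun_apply, Finset.sum_eq_single_of_mem i (by simp [hi])]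
  · have hki : k ≠ i := by rintro rfl; omega
    rw [charVec_basisFun_apply]
    simp [hk, hki, hi.not_ge]
  · intro l hl hli
    have : ¬ t ≤ l.val := by simpa using hl
    rw [charVec_basisFun_apply]
    simp [this, hli]

theorem tailCoord_single (t : ℕ) (α : Fin n → Fin n → ℤ_[p]) {j : Fin n} (k : Fin n)
    (hj : t ≤ j.val) :
    tailCoord t α k (Pi.single j 1) = (Pi.single j (1 : ℚ_[p]) : Fin n → ℚ_[p]) k := by
  rw [tailCoord_apply, Finset.sum_eq_zero, sub_zero]
  intro i hi
  have : i ≠ j := by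
    rintro rfl
    have : i.val < t := by simpa using hi
    omega
  simp [this]

theorem mem_span_sup_span_iff (t : ℕ) (α : Fin n → Fin n → ℤ_[p]) (w : Fin n → ℚ_[p]) :
    w ∈ (Submodule.span ℚ_[p]
        (charVec (Pi.basisFun ℤ (Fin n)) p t α '' {i | i.val < t})).restrictScalars ℤ_[p] ⊔
      Submodule.span ℤ_[p] ((fun j => toPadic p (Pi.basisFun ℤ (Fin n) j)) '' {j | t ≤ j.val}) ↔
    ∀ k : Fin n, t ≤ k.val → tailCoord t α k w ∈ PadicInt.subring p := by
  constructor
  · intro hw k hk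
    obtain ⟨x, hx, y, hy, rfl⟩ := Submodule.mem_sup.mp hw
    rw [map_add]
    refine add_mem ?_ ?_
    · have h1 : Submodule.span ℚ_[p] (charVec (Pi.basisFun ℤ (Fin n)) p t α '' {i | i.val < t}) ≤
          LinearMap.ker (tailCoord t α k) := by
        rw [Submodule.span_le]
        rintro _ ⟨i, hi, rfl⟩
        exact tailCoord_charVec t α hi hk
      have h2 : tailCoord t α k x = 0 := h1 hx
      rw [h2]
      exact zero_mem _
    · clear hw
      induction hy using Submodule.span_induction with
      | mem x hx =>
        obtain ⟨j, hj, rfl⟩ := hx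
        simp only [toPadic_basisFun]
        rw [tailCoord_single t α k hj, Pi.single_apply]
        split_ifs
        · exact one_mem _
        · exact zero_mem _
      | zero => simp only [map_zero]; exact zero_mem _
      | add x y _ _ hx hy =>
        rw [map_add]
        exact add_mem hx hy
      | smul c x _ hx =>
        rw [LinearMap.map_smul_of_tower]
        exact mul_mem (S := Subring ℚ_[p]) c.2 hx
  · intro h
    -- Expansion in the basis `x_0, …, x_{t-1}, e_t, …`: the head coefficients are the plain
    -- coordinates `w i` and are unrestricted; only the tail ones must be integral.
    have hw : w = (∑ i ∈ Finset.univ.filter (fun i : Fin n => i.val < t),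
        w i • charVec (Pi.basisFun ℤ (Fin n)) p t α i) +
        ∑ k ∈ Finset.univ.filter (fun k : Fin n => t ≤ k.val),
          tailCoord t α k w • Pi.single k (1 : ℚ_[p]) := by
      ext l
      simp only [Pi.add_apply, Finset.sum_apply, Pi.smul_apply, smul_eq_mul,
        charVec_basisFun_apply]
      by_cases hl : t ≤ l.val
      · have h1 : ∀ i ∈ Finset.univ.filter (fun i : Fin n => i.val < t),
            w i * ((Pi.single i (1 : ℚ_[p]) : Fin n → ℚ_[p]) l +
              if t ≤ l.val then (α i l : ℚ_[p]) else 0) = w i * (α i l : ℚ_[p]) := by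
          intro i hi
          have : l ≠ i := by
            rintro rfl
            have : l.val < t := by simpa using hi
            omega
          simp [this, hl]
        have h2 : ∑ k ∈ Finset.univ.filter (fun k : Fin n => t ≤ k.val),
            tailCoord t α k w * (Pi.single k (1 : ℚ_[p]) : Fin n → ℚ_[p]) l =
            tailCoord t α l w := by
          rw [Finset.sum_eq_single_of_mem l (by simp [hl])]
          · simp
          · intro k _ hk
            simp [hk.symm]
        rw [Finset.sum_congr rfl h1, h2, tailCoord_apply]
        ring
      · have h1 : ∑ i ∈ Finset.univ.filter (fun i : Fin n => i.val < t),
            w i * ((Pi.single i (1 : ℚ_[p]) : Fin n → ℚ_[p]) l +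
              if t ≤ l.val then (α i l : ℚ_[p]) else 0) = w l := by
          rw [Finset.sum_eq_single_of_mem l (by simpa using hl)]
          · simp [hl]
          · intro i _ hi
            simp [hl, hi.symm]
        have h2 : ∑ k ∈ Finset.univ.filter (fun k : Fin n => t ≤ k.val),
            tailCoord t α k w * (Pi.single k (1 : ℚ_[p]) : Fin n → ℚ_[p]) l = 0 := by
          refine Finset.sum_eq_zero fun k hk => ?_
          have : l ≠ k := by
            rintro rfl
            exact hl (by simpa using hk)
          simp [this]
        rw [h1, h2, add_zero]
    rw [hw]
    refine Submodule.add_mem_sup ?_ ?_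
    · refine Submodule.sum_mem _ fun i hi => Submodule.smul_mem _ _ (Submodule.subset_span ?_)
      exact ⟨i, by simpa using hi, rfl⟩
    · refine Submodule.sum_mem _ fun k hk => ?_
      have hk' : t ≤ k.val := by simpa using hk
      have := Submodule.smul_mem (Submodule.span ℤ_[p]
        ((fun j => toPadic p (Pi.basisFun ℤ (Fin n) j)) '' {j | t ≤ j.val}))
        (⟨tailCoord t α k w, h k hk'⟩ : ℤ_[p]) (Submodule.subset_span ⟨k, hk', rfl⟩)
      rw [← toPadic_basisFun]
      exact this

theorem IsCharacteristic.mem_Gbar_iff {A : Matrix (Fin n) (Fin n) ℤ}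
    {α : (p : ℕ) → [Fact p.Prime] → Fin n → Fin n → ℤ_[p]}
    (hα : IsCharacteristic A (Pi.basisFun ℤ (Fin n)) α) (hpA : p ∈ primeSet' A)
    {w : Fin n → ℚ_[p]} : w ∈ Gbar A p ↔
      ∀ k : Fin n, zeroMult A p ≤ k.val → tailCoord (zeroMult A p) (α p) k w ∈ PadicInt.subring p := by
  rw [hα p hpA, mem_span_sup_span_iff]

/-- The expression in `Cond` is the `k`-th tail coordinate of the `j`-th column of `T`, that is, of
`T e_j`. -/
theorem IsCharacteristic.cond_iff {B : Matrix (Fin n) (Fin n) ℤ}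
    {β : (p : ℕ) → [Fact p.Prime] → Fin n → Fin n → ℤ_[p]}
    (hβ : IsCharacteristic B (Pi.basisFun ℤ (Fin n)) β) (hpB : p ∈ primeSet' B)
    (T : GL (Fin n) ℚ) : Cond B p (β p) T ↔
      ∀ j : Fin n, zeroMult B p ≤ j.val → (fun i => ((T i j : ℚ) : ℚ_[p])) ∈ Gbar B p := by
  simp only [hβ.mem_Gbar_iff hpB, tailCoord_apply]
  exact ⟨fun h j hj k hk => h k j hk hj, fun h k j hk hj => h j hj k hk⟩

end Characteristic

/-! ### The valuation ring of a prime ideal -/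

section PrimeIdeal

variable {n : ℕ} {K : Type*} [Field K] [NumberField K]

theorem exists_valuationSubring {p : ℕ} [hp : Fact p.Prime] {𝔭 : Ideal (𝓞 K)}
    (h𝔭 : 𝔭 ∈ (Ideal.span {(p : ℤ)}).primesOver (𝓞 K)) :
    ∃ O : ValuationSubring K, O ≠ ⊤ ∧ (∀ μ ∈ O.nonunits, ∀ c : K, ∃ N : ℕ, μ ^ N * c ∈ O) ∧
      O.toSubring.comap (algebraMap ℚ K) = localInt p ∧
      ∀ μ : 𝓞 K, (μ : K) ∈ O.nonunits ↔ μ ∈ 𝔭 := by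
  obtain ⟨hprime, hover⟩ := h𝔭
  have hp0 : Ideal.span {(p : ℤ)} ≠ ⊥ := by
    rw [Ne, Ideal.span_singleton_eq_bot]
    exact_mod_cast hp.out.ne_zero
  let v : IsDedekindDomain.HeightOneSpectrum (𝓞 K) :=
    ⟨𝔭, hprime, Ideal.ne_bot_of_mem_primesOver hp0 ⟨hprime, hover⟩⟩
  have hnon : ∀ x : K, x ∈ (v.valuation K).valuationSubring.nonunits ↔ v.valuation K x < 1 := by
    intro x
    rw [ValuationSubring.mem_nonunits_iff]
    exact (v.valuation K).isEquiv_valuation_valuationSubring.lt_one_iff_lt_one.symm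
  have hint : ∀ m : ℤ, v.valuation K (m : K) < 1 ↔ (p : ℤ) ∣ m := by
    intro m
    have h1 : (m : K) = algebraMap (𝓞 K) K (m : 𝓞 K) := by simp
    rw [h1, IsDedekindDomain.HeightOneSpectrum.valuation_lt_one_iff_mem,
      ← Ideal.mem_span_singleton, hover.over, Ideal.mem_comap, eq_intCast]
  have hint' : ∀ m : ℤ, v.valuation K (m : K) ≤ 1 := by
    intro m
    have h1 : (m : K) = algebraMap (𝓞 K) K (m : 𝓞 K) := by simp
    rw [h1]
    exact v.valuation_le_one _
  refine ⟨(v.valuation K).valuationSubring, ?_, ?_, ?_, ?_⟩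
  · rw [Ne, Valuation.valuationSubring_eq_top_iff, not_not]
    infer_instance
  · intro μ hμ c
    rw [hnon] at hμ
    by_cases hc : c = 0
    · exact ⟨0, by simp [hc]⟩
    obtain ⟨N, hN⟩ := exists_pow_lt₀ hμ
      (Units.mk0 ((v.valuation K) c)⁻¹ (inv_ne_zero (by simpa using hc)))
    refine ⟨N, ?_⟩
    rw [Valuation.mem_valuationSubring_iff, map_mul, map_pow]
    have hc' : 0 < v.valuation K c := zero_lt_iff.mpr (by simpa using hc)
    calc _ ≤ (v.valuation K c)⁻¹ * v.valuation K c := mul_le_mul' hN.le le_rfl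
      _ = 1 := inv_mul_cancel₀ hc'.ne'
  · ext q
    rw [mem_localInt, Subring.mem_comap]
    change v.valuation K (algebraMap ℚ K q) ≤ 1 ↔ _
    have h1 : v.valuation K (algebraMap ℚ K q) * v.valuation K ((q.den : ℤ) : K) =
        v.valuation K (q.num : K) := by
      rw [← map_mul]
      have := congrArg (algebraMap ℚ K) (Rat.mul_den_eq_num q)
      rw [map_mul] at this
      simp only [map_natCast, map_intCast] at this
      rw [Int.cast_natCast, this]
    by_cases hd : p ∣ q.den
    · have h2 := (hint q.den).mpr (by exact_mod_cast hd)
      have h3 : ¬ v.valuation K (q.num : K) < 1 := by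
        rw [hint]
        intro h4
        have h5 : p ∣ q.num.natAbs := Int.natCast_dvd.mp h4
        exact hp.out.one_lt.ne' (Nat.dvd_one.mp (q.reduced ▸ Nat.dvd_gcd h5 hd))
      simp only [hd, not_true, iff_false]
      intro h4
      apply h3
      rw [← h1]
      exact (mul_le_of_le_one_left' h4).trans_lt h2
    · have h2 : v.valuation K ((q.den : ℤ) : K) = 1 :=
        le_antisymm (hint' _) (not_lt.mp fun h => hd (by exact_mod_cast (hint _).mp h))
      rw [h2, mul_one] at h1
      simp only [h1, hint', hd, not_false_eq_true]
  · intro μ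
    rw [hnon]
    exact v.valuation_lt_one_iff_mem μ

/-- The index sets differ, but every eigenvalue is an algebraic integer and the remaining `μ`
contribute zero. -/
theorem X_eq_nilPart (A : Matrix (Fin n) (Fin n) ℤ) {𝔭 : Ideal (𝓞 K)} (O : ValuationSubring K)
    (h : ∀ μ : 𝓞 K, (μ : K) ∈ O.nonunits ↔ μ ∈ 𝔭) : X A K 𝔭 = nilPart O A := by
  apply le_antisymm
  · refine iSup₂_le fun μ hμ => ?_
    exact le_iSup (fun μ : {μ : K // μ ∈ O.nonunits} => maxGenEigenspace (toEnd K A) (μ : K))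
      ⟨μ, (h μ).mpr hμ⟩
  · refine iSup_le fun ⟨μ, hμ⟩ => ?_
    by_cases hev : (toEnd K A).HasEigenvalue μ
    · have hroot : (toEnd K A).charpoly.IsRoot μ :=
        (Module.End.hasEigenvalue_iff_isRoot_charpoly _ _).mp hev
      have hmap : (toEnd K A).charpoly = A.charpoly.map (Int.castRingHom K) := by
        rw [toEnd, Matrix.charpoly_toLin']
        exact Matrix.charpoly_map A (Int.castRingHom K)
      have hint : IsIntegral ℤ μ := ⟨A.charpoly, A.charpoly_monic, by
        rw [hmap, IsRoot, eval_map] at hroot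
        exact hroot⟩
      obtain ⟨ν, rfl⟩ : ∃ ν : 𝓞 K, (ν : K) = μ := ⟨⟨μ, hint⟩, rfl⟩
      exact le_iSup₂_of_le (f := fun (μ : 𝓞 K) (_ : μ ∈ 𝔭) =>
        maxGenEigenspace (toEnd K A) (μ : K)) ν ((h ν).mp hμ) le_rfl
    · have : maxGenEigenspace (toEnd K A) μ = ⊥ := by
        by_contra hne
        exact hev (Module.End.HasUnifEigenvalue.lt zero_lt_one hne)
      simp only [this, bot_le]

end PrimeIdeal

/-! ### Generators of the localized group -/

section Generation

variable {n : ℕ} {K : Type*} [Field K] [NumberField K]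

theorem toEnd_injective {F : Type*} [Field F] [CharZero F] {A : Matrix (Fin n) (Fin n) ℤ}
    (hA : A.det ≠ 0) (k : ℕ) : Function.Injective (toEnd F A ^ k) := by
  have hdet : IsUnit (A.map (Int.cast : ℤ → F)) := by
    rw [Matrix.isUnit_iff_isUnit_det]
    have h := (Int.castRingHom F).map_det A
    rw [RingHom.mapMatrix_apply, Int.coe_castRingHom] at h
    rw [← h]
    simpa using hA
  intro v w hvw
  rw [toEnd_pow_apply, toEnd_pow_apply] at hvw
  exact Matrix.mulVec_injective_of_isUnit (hdet.pow k) hvw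

/-- `stab O A` is generated over `O` by the group `G_A`. -/
theorem stab_le_span {F : Type*} [Field F] [CharZero F] (φ : ℚ →+* F) (O : Subring F)
    {A : Matrix (Fin n) (Fin n) ℤ} (hA : A.det ≠ 0) :
    stab O A ≤ Submodule.span O ((fun v => φ ∘ v) '' (stab intRing A : Set (Fin n → ℚ))) := by
  rintro v ⟨k, hk⟩
  have hsurj : Function.Surjective (toEnd ℚ A ^ k) :=
    LinearMap.surjective_of_injective (toEnd_injective hA k)
  choose u hu using fun i => hsurj (Pi.single i 1)
  -- Here `A^k u_i = e_i`, so the coefficients are the coordinates of `A^k v`.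
  have hv : v = ∑ i, (⟨_, hk i⟩ : O) • (φ ∘ u i) := by
    apply toEnd_injective hA k
    rw [map_sum]
    simp only [LinearMap.map_smul_of_tower, toEnd_pow_comp, hu]
    ext l
    rw [Finset.sum_apply, Finset.sum_eq_single l]
    · simp [Subring.smul_def]
    · intro j _ hj
      simp [hj.symm]
    · simp
  rw [hv]
  refine Submodule.sum_mem _ fun i _ => Submodule.smul_mem _ _ (Submodule.subset_span ⟨u i, ?_, rfl⟩)
  refine ⟨k, mem_lattice_intRing.mpr ⟨Pi.single i 1, ?_⟩⟩
  rw [hu]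
  ext l
  by_cases h : l = i
  · subst h; simp
  · simp [h]

theorem lattice_le_span {F : Type*} [Field F] (O : Subring F) :
    lattice n O ≤ Submodule.span O (Set.range fun i : Fin n => (Pi.single i 1 : Fin n → F)) := by
  intro v hv
  have : v = ∑ i, (⟨v i, hv i⟩ : O) • (Pi.single i 1 : Fin n → F) := by
    ext l
    rw [Finset.sum_apply, Finset.sum_eq_single l]
    · simp [Subring.smul_def]
    · intro j _ hj
      simp [hj.symm]
    · simp
  rw [this]
  exact Submodule.sum_mem _ fun i _ => Submodule.smul_mem _ _ (Submodule.subset_span ⟨i, rfl⟩)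

theorem span_le_lattice {F : Type*} [Field F] (O : Subring F) :
    Submodule.span O (Set.range fun i : Fin n => (Pi.single i 1 : Fin n → F)) ≤ lattice n O := by
  rw [Submodule.span_le]
  rintro _ ⟨i, rfl⟩ j
  by_cases h : j = i
  · subst h; simp
  · simp [h]

variable {p : ℕ} [hp : Fact p.Prime]

/-- Modulo the `p`-divisible part, each `e_i` is an integral combination of the `e_j` with
`j ≥ t` up to `p`-multiples. -/
theorem IsCharacteristic.exists_approx {A : Matrix (Fin n) (Fin n) ℤ} (hA : A.det ≠ 0)
    {α : (p : ℕ) → [Fact p.Prime] → Fin n → Fin n → ℤ_[p]}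
    (hα : IsCharacteristic A (Pi.basisFun ℤ (Fin n)) α) (hpA : p ∈ primeSet' A) {i : Fin n}
    (hi : i.val < zeroMult A p) : ∃ a : Fin n → ℤ,
      (p : ℚ)⁻¹ • ((Pi.single i 1 : Fin n → ℚ) +
        ∑ j ∈ Finset.univ.filter (fun j : Fin n => zeroMult A p ≤ j.val),
          (a j : ℚ) • (Pi.single j 1 : Fin n → ℚ)) ∈ stab (localInt p) A := by
  -- The integers `a j` reduce `α p i j` modulo `p`. Dividing by `p` then leaves integral tail
  -- coordinates, because those of `x_{pi}` vanish.
  choose a ha using fun j => PadicInt.exists_mem_range (x := α p i j)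
  refine ⟨fun j => a j, mem_stab_localInt_of_mem_Gbar hA ((hα.mem_Gbar_iff hpA).mpr fun k hk => ?_)⟩
  set t := zeroMult A p
  have hp0 : (p : ℚ_[p]) ≠ 0 := Nat.cast_ne_zero.mpr hp.out.ne_zero
  have hcoord : (fun l => (((p : ℚ)⁻¹ • ((Pi.single i 1 : Fin n → ℚ) +
        ∑ j ∈ Finset.univ.filter (fun j : Fin n => t ≤ j.val),
          ((a j : ℤ) : ℚ) • (Pi.single j 1 : Fin n → ℚ))) l : ℚ_[p])) =
      (p : ℚ_[p])⁻¹ • ((charVec (Pi.basisFun ℤ (Fin n)) p t (α p) i) +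
        ∑ j ∈ Finset.univ.filter (fun j : Fin n => t ≤ j.val),
          ((a j : ℚ_[p]) - α p i j) • (Pi.single j 1 : Fin n → ℚ_[p])) := by
    ext l
    simp only [Pi.smul_apply, Pi.add_apply, Finset.sum_apply, charVec_basisFun_apply,
      Pi.single_apply, smul_eq_mul, mul_ite, mul_one, mul_zero, Finset.sum_ite_eq,
      Finset.mem_filter, Finset.mem_univ, true_and]
    split_ifs <;> push_cast <;> ring
  rw [hcoord, map_smul, map_add, tailCoord_charVec t (α p) hi hk, zero_add, map_sum,
    Finset.sum_eq_single_of_mem k (by simpa using hk)]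
  · obtain ⟨c, hc⟩ := Ideal.mem_span_singleton'.mp (PadicInt.maximalIdeal_eq_span_p (p := p) ▸ (ha k).2)
    have hc' : (a k : ℚ_[p]) - α p i k = -(c * p : ℚ_[p]) := by
      have := congrArg (fun x : ℤ_[p] => (x : ℚ_[p])) hc
      push_cast at this
      rw [this]
      ring
    rw [map_smul, tailCoord_single t _ k hk, hc', Pi.single_eq_same, smul_eq_mul, smul_eq_mul,
      mul_one, mul_neg, mul_comm (c : ℚ_[p]), inv_mul_cancel_left₀ hp0]
    exact neg_mem (S := Subring ℚ_[p]) c.2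
  · intro j hj hjk
    rw [map_smul, tailCoord_single t _ k (by simpa using hj)]
    simp [hjk.symm]

/-- `G_A ⊗ O` is generated by the divisible part and the `e_j` with `j ≥ t`. -/
theorem IsCharacteristic.stab_le {A : Matrix (Fin n) (Fin n) ℤ} (hA : A.det ≠ 0)
    (hKA : (A.map (Int.cast : ℤ → K)).charpoly.Splits)
    {α : (p : ℕ) → [Fact p.Prime] → Fin n → Fin n → ℤ_[p]}
    (hα : IsCharacteristic A (Pi.basisFun ℤ (Fin n)) α) (hpA : p ∈ primeSet' A)
    {O : ValuationSubring K} (hcomap : O.toSubring.comap (algebraMap ℚ K) = localInt p)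
    (hpO : (p : K) ∈ O.nonunits) :
    stab O.toSubring A ≤ (nilPart O A).restrictScalars O.toSubring ⊔
      Submodule.span O.toSubring
        ((fun j : Fin n => (Pi.single j 1 : Fin n → K)) '' {j | zeroMult A p ≤ j.val}) := by
  set N := (nilPart O A).restrictScalars O.toSubring ⊔ Submodule.span O.toSubring
        ((fun j : Fin n => (Pi.single j 1 : Fin n → K)) '' {j | zeroMult A p ≤ j.val}) with hN
  obtain ⟨P, hP, hP'⟩ := exists_projection O A hKA
  suffices hlat : lattice n O.toSubring ≤ N by
    intro v hv
    rw [← sub_add_cancel v (P v)]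
    exact add_mem (Submodule.mem_sup_left (hP v)) (hlat (hP' v hv))
  have : IsLocalRing O.toSubring := inferInstanceAs (IsLocalRing O)
  set I : Ideal O.toSubring := IsLocalRing.maximalIdeal O.toSubring
  have hpI : (⟨(p : K), O.nonunits_subset hpO⟩ : O.toSubring) ∈ I :=
    (ValuationSubring.coe_mem_nonunits_iff (A := O) (a := ⟨(p : K), O.nonunits_subset hpO⟩)).mp hpO
  have htail : ∀ j : Fin n, zeroMult A p ≤ j.val → (Pi.single j 1 : Fin n → K) ∈ N := fun j hj =>
    Submodule.mem_sup_right (Submodule.subset_span ⟨j, hj, rfl⟩)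
  -- Nakayama's lemma: since `Oⁿ` is finitely generated, `Oⁿ ≤ N + I Oⁿ` suffices. Agreement modulo
  -- `p` is thus enough, and the `p`-adic numbers need not be embedded in an extension of `K`.
  refine Submodule.le_of_le_smul_of_le_jacobson_bot (I := I) ?_
    (IsLocalRing.maximalIdeal_le_jacobson _) ?_
  · rw [le_antisymm (lattice_le_span O.toSubring) (span_le_lattice (n := n) O.toSubring)]
    exact Submodule.fg_span (Set.finite_range _)
  · refine (lattice_le_span O.toSubring).trans (Submodule.span_le.mpr ?_)
    rintro _ ⟨i, rfl⟩
    rcases le_or_gt (zeroMult A p) i.val with hi | hi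
    · exact Submodule.mem_sup_left (htail i hi)
    obtain ⟨a, ha⟩ := hα.exists_approx hA hpA hi
    rw [← hcomap, ← comp_mem_stab_iff] at ha
    set u := algebraMap ℚ K ∘ ((p : ℚ)⁻¹ • ((Pi.single i 1 : Fin n → ℚ) +
        ∑ j ∈ Finset.univ.filter (fun j : Fin n => zeroMult A p ≤ j.val),
          (a j : ℚ) • (Pi.single j 1 : Fin n → ℚ))) with hu
    have hp0 : (p : K) ≠ 0 := Nat.cast_ne_zero.mpr hp.out.ne_zero
    -- Write `p u = p (u - P u) + p (P u)`: the first term lies in `nilPart`, the second in `I Oⁿ`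
    -- because `P` is integral on `stab`.
    have hei : (Pi.single i 1 : Fin n → K) = ((p : K) • (u - P u) -
        ∑ j ∈ Finset.univ.filter (fun j : Fin n => zeroMult A p ≤ j.val),
          (a j : O.toSubring) • (Pi.single j 1 : Fin n → K)) +
        (⟨(p : K), O.nonunits_subset hpO⟩ : O.toSubring) • P u := by
      have h1 : (p : K) • u = Pi.single i 1 +
          ∑ j ∈ Finset.univ.filter (fun j : Fin n => zeroMult A p ≤ j.val),
            (a j : O.toSubring) • (Pi.single j 1 : Fin n → K) := by
        ext l
        simp only [hu, Pi.smul_apply, Pi.add_apply, Finset.sum_apply, Function.comp_apply,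
          Pi.single_apply, smul_eq_mul, mul_ite, mul_one, mul_zero, Finset.sum_ite_eq,
          Finset.mem_filter, Finset.mem_univ, true_and, Subring.smul_def]
        split_ifs <;> simp [hp0]
      have h2 : (⟨(p : K), O.nonunits_subset hpO⟩ : O.toSubring) • P u = (p : K) • P u := rfl
      rw [h2, smul_sub, h1]
      abel
    simp only [SetLike.mem_coe]
    rw [hei]
    refine Submodule.add_mem_sup (sub_mem ?_ ?_) (Submodule.smul_mem_smul hpI (hP' u ha))
    · exact Submodule.mem_sup_left (Submodule.smul_mem (nilPart O A) _ (hP u))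
    · exact Submodule.sum_mem _ fun j hj => Submodule.smul_mem _ _ (htail j (by simpa using hj))

end Generation

/-! ### Transport by `T` and the local conditions -/

section Main

variable {n : ℕ} {K : Type*} [Field K] [NumberField K]

theorem comp_mulVec (T : GL (Fin n) ℚ) {F : Type*} [Field F] (φ : ℚ →+* F) (v : Fin n → ℚ) :
    φ ∘ (T : Matrix (Fin n) (Fin n) ℚ).mulVec v =
      Matrix.toLin' ((T : Matrix (Fin n) (Fin n) ℚ).map φ) (φ ∘ v) := by
  ext i
  exact RingHom.map_mulVec φ _ v i

theorem mulVec_mem_stab {A B : Matrix (Fin n) (Fin n) ℤ} (hA : A.det ≠ 0) (O : Subring K)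
    (T : GL (Fin n) ℚ)
    (hT : ∀ v ∈ stab intRing A, (T : Matrix (Fin n) (Fin n) ℚ).mulVec v ∈ stab intRing B)
    {v : Fin n → K} (hv : v ∈ stab O A) :
    Matrix.toLin' ((T : Matrix (Fin n) (Fin n) ℚ).map (algebraMap ℚ K)) v ∈ stab O B := by
  have hv' := stab_le_span (algebraMap ℚ K) O hA hv
  clear hv
  induction hv' using Submodule.span_induction with
  | mem x hx =>
    obtain ⟨u, hu, rfl⟩ := hx
    rw [← comp_mulVec, comp_mem_stab_iff]
    exact stab_mono (intRing_le _) (hT u hu)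
  | zero => rw [map_zero]; exact zero_mem _
  | add x y _ _ hx hy => rw [map_add]; exact add_mem hx hy
  | smul c x _ hx =>
    rw [LinearMap.map_smul_of_tower]
    exact Submodule.smul_mem _ c hx

/-- By `mem_nilPart_iff`, both sides are described by lines contained in `stab`, and the `K`-linear
extension of `T` carries such lines to such lines. -/
theorem X_map_le_of_mulVec_mem {A B : Matrix (Fin n) (Fin n) ℤ} (hA : A.det ≠ 0)
    (hKA : (A.map (Int.cast : ℤ → K)).charpoly.Splits)
    (hKB : (B.map (Int.cast : ℤ → K)).charpoly.Splits) (T : GL (Fin n) ℚ)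
    (hT : ∀ v ∈ stab intRing A, (T : Matrix (Fin n) (Fin n) ℚ).mulVec v ∈ stab intRing B)
    {p : ℕ} [Fact p.Prime] {𝔭 : Ideal (𝓞 K)}
    (h𝔭 : 𝔭 ∈ (Ideal.span {(p : ℤ)}).primesOver (𝓞 K)) :
    (X A K 𝔭).map (Matrix.toLin' ((T : Matrix (Fin n) (Fin n) ℚ).map (algebraMap ℚ K))) ≤
      X B K 𝔭 := by
  obtain ⟨O, hOtop, hO, -, hmem⟩ := exists_valuationSubring h𝔭
  rw [X_eq_nilPart A O hmem, X_eq_nilPart B O hmem]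
  rintro _ ⟨v, hv, rfl⟩
  rw [mem_nilPart_iff O hO hOtop B hKB]
  intro c
  rw [← map_smul]
  exact mulVec_mem_stab hA _ T hT ((mem_nilPart_iff O hO hOtop A hKA).mp hv c)

theorem toLin'_inv_comp (T : GL (Fin n) ℚ) (v : Fin n → K) :
    Matrix.toLin' ((T : Matrix (Fin n) (Fin n) ℚ).map (algebraMap ℚ K))
      (Matrix.toLin' (((T⁻¹ : GL (Fin n) ℚ) : Matrix (Fin n) (Fin n) ℚ).map (algebraMap ℚ K)) v) = v := by
  rw [← LinearMap.comp_apply, ← Matrix.toLin'_mul, ← Matrix.map_mul, ← Units.val_mul,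
    mul_inv_cancel, Units.val_one, Matrix.map_one _ (map_zero _) (map_one _), Matrix.toLin'_one,
    LinearMap.id_apply]

theorem mulVec_inv_mulVec (T : GL (Fin n) ℚ) (v : Fin n → ℚ) :
    (T : Matrix (Fin n) (Fin n) ℚ).mulVec
      (((T⁻¹ : GL (Fin n) ℚ) : Matrix (Fin n) (Fin n) ℚ).mulVec v) = v := by
  rw [Matrix.mulVec_mulVec, ← Units.val_mul, mul_inv_cancel, Units.val_one, Matrix.one_mulVec]

theorem mulVec_image_eq_iff {A B : Matrix (Fin n) (Fin n) ℤ} (hA : A.det ≠ 0) (hB : B.det ≠ 0)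
    (T : GL (Fin n) ℚ) : (T : Matrix (Fin n) (Fin n) ℚ).mulVec '' G A = G B ↔
      (∀ v ∈ stab intRing A, (T : Matrix (Fin n) (Fin n) ℚ).mulVec v ∈ stab intRing B) ∧
      ∀ v ∈ stab intRing B, ((T⁻¹ : GL (Fin n) ℚ) : Matrix (Fin n) (Fin n) ℚ).mulVec v ∈ stab intRing A := by
  have hGA : G A = (stab intRing A : Set (Fin n → ℚ)) := Set.ext fun v => mem_G_iff hA
  have hGB : G B = (stab intRing B : Set (Fin n → ℚ)) := Set.ext fun v => mem_G_iff hB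
  rw [hGA, hGB]
  constructor
  · intro h
    refine ⟨fun v hv => ?_, fun v hv => ?_⟩
    · have : (T : Matrix (Fin n) (Fin n) ℚ).mulVec v ∈ (stab intRing B : Set (Fin n → ℚ)) :=
        h ▸ ⟨v, hv, rfl⟩
      exact this
    · obtain ⟨w, hw, rfl⟩ := h.symm.subset hv
      have := mulVec_inv_mulVec T⁻¹ w
      rw [inv_inv] at this
      rwa [this]
  · rintro ⟨h, h'⟩
    refine Set.Subset.antisymm ?_ fun v hv => ⟨_, h' v hv, mulVec_inv_mulVec T v⟩
    rintro _ ⟨v, hv, rfl⟩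
    exact h v hv

theorem mapsX_of_mulVec_mem {A B : Matrix (Fin n) (Fin n) ℤ} (hA : A.det ≠ 0) (hB : B.det ≠ 0)
    (hKA : (A.map (Int.cast : ℤ → K)).charpoly.Splits)
    (hKB : (B.map (Int.cast : ℤ → K)).charpoly.Splits) (T : GL (Fin n) ℚ)
    (hT : ∀ v ∈ stab intRing A, (T : Matrix (Fin n) (Fin n) ℚ).mulVec v ∈ stab intRing B)
    (hT' : ∀ v ∈ stab intRing B,
      ((T⁻¹ : GL (Fin n) ℚ) : Matrix (Fin n) (Fin n) ℚ).mulVec v ∈ stab intRing A)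
    {p : ℕ} [Fact p.Prime] {𝔭 : Ideal (𝓞 K)}
    (h𝔭 : 𝔭 ∈ (Ideal.span {(p : ℤ)}).primesOver (𝓞 K)) : MapsX A B K 𝔭 T :=
  le_antisymm (X_map_le_of_mulVec_mem hA hKA hKB T hT h𝔭) fun v hv =>
    ⟨_, X_map_le_of_mulVec_mem hB hKB hKA T⁻¹ hT' h𝔭 ⟨v, hv, rfl⟩, toLin'_inv_comp T v⟩

theorem mapsX_inv {A B : Matrix (Fin n) (Fin n) ℤ} {𝔭 : Ideal (𝓞 K)} {T : GL (Fin n) ℚ}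
    (h : MapsX A B K 𝔭 T) : MapsX B A K 𝔭 T⁻¹ := by
  rw [MapsX] at h ⊢
  rw [← h, ← Submodule.map_comp]
  convert Submodule.map_id _
  refine LinearMap.ext fun v => ?_
  have := toLin'_inv_comp (K := K) T⁻¹ v
  rwa [inv_inv] at this

/-- The local conditions imply `T(G_A) ⊆ G_B`. -/
theorem mulVec_mem_of_conditions {A B : Matrix (Fin n) (Fin n) ℤ} (hA : A.det ≠ 0)
    (hB : B.det ≠ 0) (hKA : (A.map (Int.cast : ℤ → K)).charpoly.Splits)
    {α β : (p : ℕ) → [Fact p.Prime] → Fin n → Fin n → ℤ_[p]}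
    (hα : IsCharacteristic A (Pi.basisFun ℤ (Fin n)) α)
    (hβ : IsCharacteristic B (Pi.basisFun ℤ (Fin n)) β) (T : GL (Fin n) ℚ)
    (hP : primeSet A = primeSet B) (hP' : primeSet' A = primeSet' B)
    (ht : ∀ p ∈ primeSet A, zeroMult A p = zeroMult B p) (hR : ∀ i j, T i j ∈ R A)
    (hX : ∀ p ∈ primeSet' A,
      ∃ 𝔭 ∈ (Ideal.span {(p : ℤ)}).primesOver (𝓞 K), MapsX A B K 𝔭 T)
    (hC : ∀ (p : ℕ) [Fact p.Prime], p ∈ primeSet' A → Cond B p (β p) T)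
    {v : Fin n → ℚ} (hv : v ∈ stab intRing A) :
    (T : Matrix (Fin n) (Fin n) ℚ).mulVec v ∈ stab intRing B := by
  refine mem_stab_intRing_of_local fun p hp => ?_
  have : Fact p.Prime := ⟨hp⟩
  by_cases hpA : p ∈ primeSet A
  swap
  · apply exists_smul_mem_of_mem_stab_localInt (p := p)
    apply lattice_le_stab
    intro i
    rw [Matrix.mulVec, dotProduct]
    exact sum_mem fun j _ => mul_mem (R_le_localInt hpA (hR i j))
      (R_le_localInt hpA (mem_R_of_mem_stab hA hv j))
  by_cases hpA' : p ∈ primeSet' A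
  swap
  · set w := (T : Matrix (Fin n) (Fin n) ℚ).mulVec v
    rw [hP'] at hpA'
    rw [hP] at hpA
    have hdiv : ∀ a : ℕ, ∀ u ∈ stab intRing B, ((p : ℚ) ^ a)⁻¹ • u ∈ stab intRing B := by
      intro a
      induction a with
      | zero => intro u hu; simpa using hu
      | succ a ih =>
        intro u hu
        rw [pow_succ, mul_inv, mul_smul]
        exact ih _ (inv_smul_mem_stab hpA hpA' hu)
    set d := ∏ i, (w i).den with hd
    have hd0 : d ≠ 0 := Finset.prod_ne_zero_iff.mpr fun i _ => (w i).den_nz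
    -- The common denominator is `d = p^a m`; `p`-divisibility of the module removes `p^a`, leaving
    -- the multiplier `m` prime to `p`.
    obtain ⟨a, m, hm, hdm⟩ := Nat.exists_eq_pow_mul_and_not_dvd hd0 p hp.ne_one
    refine ⟨m, by exact_mod_cast hm, ?_⟩
    have h1 : (d : ℚ) • w ∈ stab intRing B := by
      apply lattice_le_stab
      simpa [hd] using prod_den_smul_mem_lattice w
    have h2 := hdiv a _ h1
    rwa [hdm, Nat.cast_mul, Nat.cast_pow, mul_smul,
      inv_smul_smul₀ (pow_ne_zero _ (Nat.cast_ne_zero.mpr hp.ne_zero))] at h2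
  · obtain ⟨𝔭, h𝔭, hmap⟩ := hX p hpA'
    obtain ⟨O, hOtop, hO, hcomap, hmem⟩ := exists_valuationSubring h𝔭
    apply exists_smul_mem_of_mem_stab_localInt (p := p)
    -- The question moves from `ℚ` to `K`, where `X_{A,𝔭}` is defined; a single `𝔭` suffices because
    -- `O ∩ ℚ` is the localization of `ℤ` at `p`.
    rw [← hcomap, ← comp_mem_stab_iff, comp_mulVec]
    have hpO : (p : K) ∈ O.nonunits := by
      have h1 := (hmem (p : 𝓞 K)).mpr (by
        have h2 : (p : ℤ) ∈ Ideal.span {(p : ℤ)} := Ideal.mem_span_singleton_self _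
        rw [h𝔭.2.over, Ideal.mem_comap] at h2
        simpa using h2)
      simpa using h1
    have hvK : algebraMap ℚ K ∘ v ∈ stab O.toSubring A :=
      (comp_mem_stab_iff _ _ _).mpr (stab_mono (intRing_le _) hv)
    obtain ⟨x, hx, y, hy, hxy⟩ :=
      Submodule.mem_sup.mp (hα.stab_le hA hKA hpA' hcomap hpO hvK)
    rw [← hxy, map_add]
    refine add_mem ?_ ?_
    · apply nilPart_le_stab hO
      rw [← X_eq_nilPart B O hmem, ← hmap]
      refine ⟨x, ?_, rfl⟩
      rw [X_eq_nilPart A O hmem]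
      exact hx
    · clear hxy
      induction hy using Submodule.span_induction with
      | mem z hz =>
        obtain ⟨j, hj, rfl⟩ := hz
        have h1 : (Pi.single j 1 : Fin n → K) = algebraMap ℚ K ∘ (Pi.single j 1 : Fin n → ℚ) := by
          ext l
          by_cases h : l = j
          · subst h; simp
          · simp [h]
        simp only
        rw [h1, ← comp_mulVec, comp_mem_stab_iff, hcomap, Matrix.mulVec_single_one]
        exact mem_stab_localInt_of_mem_Gbar hB
          ((hβ.cond_iff (hP' ▸ hpA') T).mp (hC p hpA') j (ht p hpA ▸ hj))
      | zero => rw [map_zero]; exact zero_mem _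
      | add x y _ _ hx hy => rw [map_add]; exact add_mem hx hy
      | smul c x _ hx =>
        rw [LinearMap.map_smul_of_tower]
        exact Submodule.smul_mem _ c hx

theorem single_mem_stab (A : Matrix (Fin n) (Fin n) ℤ) (j : Fin n) :
    (Pi.single j 1 : Fin n → ℚ) ∈ stab intRing A := by
  apply lattice_le_stab
  exact span_le_lattice intRing (Submodule.subset_span ⟨j, rfl⟩)

theorem entry_mem_R {A B : Matrix (Fin n) (Fin n) ℤ} (hB : B.det ≠ 0) (T : GL (Fin n) ℚ)
    (hT : ∀ v ∈ stab intRing A, (T : Matrix (Fin n) (Fin n) ℚ).mulVec v ∈ stab intRing B)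
    (i j : Fin n) : T i j ∈ R B := by
  have := mem_R_of_mem_stab hB (hT _ (single_mem_stab A j)) i
  rwa [Matrix.mulVec_single_one] at this

/-- The columns of `T` are images of vectors of `ℤⁿ ⊆ G_A`, so all of them lie in `G_B`. -/
theorem cond_of_mulVec_mem {A B : Matrix (Fin n) (Fin n) ℤ} (hB : B.det ≠ 0)
    {β : (p : ℕ) → [Fact p.Prime] → Fin n → Fin n → ℤ_[p]}
    (hβ : IsCharacteristic B (Pi.basisFun ℤ (Fin n)) β) (T : GL (Fin n) ℚ)
    (hT : ∀ v ∈ stab intRing A, (T : Matrix (Fin n) (Fin n) ℚ).mulVec v ∈ stab intRing B)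
    {p : ℕ} [Fact p.Prime] (hp : p ∈ primeSet' B) : Cond B p (β p) T := by
  rw [hβ.cond_iff hp]
  intro j _
  have := hT _ (single_mem_stab A j)
  rw [Matrix.mulVec_single_one, ← mem_G_iff hB] at this
  exact Submodule.subset_span ⟨_, this, rfl⟩

theorem zeroMult_eq_of_mulVec_mem {A B : Matrix (Fin n) (Fin n) ℤ} (T : GL (Fin n) ℚ)
    (hT : ∀ v ∈ stab intRing A, (T : Matrix (Fin n) (Fin n) ℚ).mulVec v ∈ stab intRing B)
    (hT' : ∀ v ∈ stab intRing B,
      ((T⁻¹ : GL (Fin n) ℚ) : Matrix (Fin n) (Fin n) ℚ).mulVec v ∈ stab intRing A)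
    (p : ℕ) [Fact p.Prime] : zeroMult A p = zeroMult B p := by
  refine zeroMult_eq_of_map_eq (Matrix.toLin' (T : Matrix (Fin n) (Fin n) ℚ))
    (Matrix.mulVec_injective_of_isUnit T.isUnit) (fun v => ?_) p
  constructor
  · intro hv
    exact ⟨_, hT' v hv, mulVec_inv_mulVec T v⟩
  · rintro ⟨w, hw, rfl⟩
    exact hT w hw

end Main

end Solenoid

/-! ### The two equivalences -/

open Solenoid in
theorem theorem4p2 {n : ℕ} (A B : Matrix (Fin n) (Fin n) ℤ) (hA : A.det ≠ 0) (hB : B.det ≠ 0)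
    (K : Type*) [Field K] [NumberField K]
    (hKA : (A.map (Int.cast : ℤ → K)).charpoly.Splits)
    (hKB : (B.map (Int.cast : ℤ → K)).charpoly.Splits)
    (α β : (p : ℕ) → [Fact p.Prime] → Fin n → Fin n → ℤ_[p])
    (hα : Solenoid.IsCharacteristic A (Pi.basisFun ℤ (Fin n)) α)
    (hβ : Solenoid.IsCharacteristic B (Pi.basisFun ℤ (Fin n)) β)
    (T : GL (Fin n) ℚ) :
    -- the criterion with all prime ideals above each `p ∈ 𝒫'`
    ((T : Matrix (Fin n) (Fin n) ℚ).mulVec '' Solenoid.G A = Solenoid.G B ↔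
      Solenoid.primeSet A = Solenoid.primeSet B ∧
      Solenoid.primeSet' A = Solenoid.primeSet' B ∧
      Solenoid.R A = Solenoid.R B ∧
      (∀ p ∈ Solenoid.primeSet A, Solenoid.zeroMult A p = Solenoid.zeroMult B p) ∧
      T ∈ Solenoid.GLR A ∧
      (∀ p ∈ Solenoid.primeSet' A,
        ∀ 𝔭 ∈ (Ideal.span {(p : ℤ)}).primesOver (𝓞 K), Solenoid.MapsX A B K 𝔭 T) ∧
      (∀ (p : ℕ) [Fact p.Prime], p ∈ Solenoid.primeSet' A →
        Solenoid.Cond B p (β p) T ∧ Solenoid.Cond A p (α p) T⁻¹)) ∧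
    -- the criterion with just one prime ideal above each `p ∈ 𝒫'`
    ((T : Matrix (Fin n) (Fin n) ℚ).mulVec '' Solenoid.G A = Solenoid.G B ↔
      Solenoid.primeSet A = Solenoid.primeSet B ∧
      Solenoid.primeSet' A = Solenoid.primeSet' B ∧
      Solenoid.R A = Solenoid.R B ∧
      (∀ p ∈ Solenoid.primeSet A, Solenoid.zeroMult A p = Solenoid.zeroMult B p) ∧
      T ∈ Solenoid.GLR A ∧
      (∀ p ∈ Solenoid.primeSet' A,
        ∃ 𝔭 ∈ (Ideal.span {(p : ℤ)}).primesOver (𝓞 K), Solenoid.MapsX A B K 𝔭 T) ∧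
      (∀ (p : ℕ) [Fact p.Prime], p ∈ Solenoid.primeSet' A →
        Solenoid.Cond B p (β p) T ∧ Solenoid.Cond A p (α p) T⁻¹)) := by
  have key : ((∀ v ∈ stab intRing A, (T : Matrix (Fin n) (Fin n) ℚ).mulVec v ∈ stab intRing B) ∧
      ∀ v ∈ stab intRing B,
        ((T⁻¹ : GL (Fin n) ℚ) : Matrix (Fin n) (Fin n) ℚ).mulVec v ∈ stab intRing A) →
      primeSet A = primeSet B ∧ primeSet' A = primeSet' B ∧ R A = R B ∧
      (∀ p ∈ primeSet A, zeroMult A p = zeroMult B p) ∧ T ∈ GLR A ∧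
      (∀ p ∈ primeSet' A, ∀ 𝔭 ∈ (Ideal.span {(p : ℤ)}).primesOver (𝓞 K), MapsX A B K 𝔭 T) ∧
      (∀ (p : ℕ) [Fact p.Prime], p ∈ primeSet' A → Cond B p (β p) T ∧ Cond A p (α p) T⁻¹) := by
    rintro ⟨hT, hT'⟩
    have ht : ∀ p : ℕ, p.Prime → zeroMult A p = zeroMult B p := fun p hp =>
      have : Fact p.Prime := ⟨hp⟩
      zeroMult_eq_of_mulVec_mem T hT hT' p
    have hP : primeSet A = primeSet B := by
      ext p
      by_cases hp : p.Prime
      · have : Fact p.Prime := ⟨hp⟩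
        rw [mem_primeSet_iff, mem_primeSet_iff, ht p hp]
      · exact iff_of_false (fun h => hp h.1) fun h => hp h.1
    have hP' : primeSet' A = primeSet' B := by
      ext p
      by_cases hp : p.Prime
      · have : Fact p.Prime := ⟨hp⟩
        rw [mem_primeSet'_iff, mem_primeSet'_iff, ht p hp]
      · exact iff_of_false (fun h => hp h.1.1) fun h => hp h.1.1
    have hR : R A = R B :=
      le_antisymm (R_le_of_primeSet_subset hA hB hP.subset)
        (R_le_of_primeSet_subset hB hA hP.symm.subset)
    refine ⟨hP, hP', hR, fun p hp => ht p hp.1, mem_GLR_iff.mpr ⟨?_, ?_⟩, ?_, ?_⟩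
    · rw [hR]
      exact entry_mem_R hB T hT
    · exact entry_mem_R hA T⁻¹ hT'
    · intro p hp 𝔭 h𝔭
      have : Fact p.Prime := ⟨hp.1.1⟩
      exact mapsX_of_mulVec_mem hA hB hKA hKB T hT hT' h𝔭
    · intro p _ hp
      exact ⟨cond_of_mulVec_mem hB hβ T hT (hP' ▸ hp), cond_of_mulVec_mem hA hα T⁻¹ hT' hp⟩
  have key' : (primeSet A = primeSet B ∧ primeSet' A = primeSet' B ∧ R A = R B ∧
      (∀ p ∈ primeSet A, zeroMult A p = zeroMult B p) ∧ T ∈ GLR A ∧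
      (∀ p ∈ primeSet' A, ∃ 𝔭 ∈ (Ideal.span {(p : ℤ)}).primesOver (𝓞 K), MapsX A B K 𝔭 T) ∧
      (∀ (p : ℕ) [Fact p.Prime], p ∈ primeSet' A → Cond B p (β p) T ∧ Cond A p (α p) T⁻¹)) →
      ((∀ v ∈ stab intRing A, (T : Matrix (Fin n) (Fin n) ℚ).mulVec v ∈ stab intRing B) ∧
      ∀ v ∈ stab intRing B,
        ((T⁻¹ : GL (Fin n) ℚ) : Matrix (Fin n) (Fin n) ℚ).mulVec v ∈ stab intRing A) := by
    rintro ⟨hP, hP', hR, ht, hGL, hX, hC⟩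
    obtain ⟨hT, hT'⟩ := mem_GLR_iff.mp hGL
    refine ⟨fun v => mulVec_mem_of_conditions hA hB hKA hα hβ T hP hP' ht hT hX
      fun p _ hp => (hC p hp).1, fun v => mulVec_mem_of_conditions hB hA hKB hβ hα T⁻¹ hP.symm
        hP'.symm (fun p hp => (ht p (hP ▸ hp)).symm) (hR ▸ hT') (fun p hp => ?_)
        fun p _ hp => (hC p (hP' ▸ hp)).2⟩
    obtain ⟨𝔭, h𝔭, h⟩ := hX p (hP' ▸ hp)
    exact ⟨𝔭, h𝔭, mapsX_inv h⟩
  -- Without a prime above `p`, the version of condition 3 for all `𝔭` would not imply the version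
  -- for some `𝔭`.
  have hexists : ∀ p ∈ primeSet' A, ∃ 𝔭, 𝔭 ∈ (Ideal.span {(p : ℤ)}).primesOver (𝓞 K) := by
    intro p hp
    have hprime : Prime (p : ℤ) := Nat.prime_iff_prime_int.mp hp.1.1
    have : (Ideal.span {(p : ℤ)}).IsPrime := (Ideal.span_singleton_prime hprime.ne_zero).mpr hprime
    obtain ⟨𝔭⟩ := (inferInstance : Nonempty ((Ideal.span {(p : ℤ)}).primesOver (𝓞 K)))
    exact ⟨𝔭.1, 𝔭.2⟩
  rw [mulVec_image_eq_iff hA hB T]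
  have weaken : (∀ p ∈ primeSet' A,
      ∀ 𝔭 ∈ (Ideal.span {(p : ℤ)}).primesOver (𝓞 K), MapsX A B K 𝔭 T) → ∀ p ∈ primeSet' A,
      ∃ 𝔭 ∈ (Ideal.span {(p : ℤ)}).primesOver (𝓞 K), MapsX A B K 𝔭 T := fun h p hp =>
    let ⟨𝔭, h𝔭⟩ := hexists p hp
    ⟨𝔭, h𝔭, h p hp 𝔭 h𝔭⟩
  refine ⟨⟨key, fun ⟨h1, h2, h3, h4, h5, h6, h7⟩ => key' ⟨h1, h2, h3, h4, h5, weaken h6, h7⟩⟩,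
    ⟨fun h => ?_, key'⟩⟩
  obtain ⟨h1, h2, h3, h4, h5, h6, h7⟩ := key h
  exact ⟨h1, h2, h3, h4, h5, weaken h6, h7⟩
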